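/- Let $d\ge 2$, let $M$ be a compact $C^\infty$ manifold of dimension $d+1$, and let $(\phi^t)_{t\in\mathbb R}$ be a $C^\infty$ Anosov flow on $M$ generated by a $C^\infty$ vector field $V$, with hyperbolic splitting $T_xM=E^u_x\oplus E^s_x\oplus\mathbb R V(x)$. Let $g:M\to\mathbb C$ be $C^\infty$ and put $X=V+g$. For $t\ge 0$ let $\mathcal L_t u=\exp\left(\int_0^t g\circ\phi^\tau\,d\tau\right)u\circ\phi^t$, acting on the space $\mathcal D'(M)$ of distributions (the dual of the space of smooth densities). *Resonances.* A number $\lambda\in\mathbb C$ is a *Ruelle resonance* of $X$ of multiplicity $m\ge 1$ if for some $A>0$ with $\operatorname{Re}\lambda>-A$ there is a Banach space $\mathcal B$ such that: $C^\infty(M)\subseteq\mathcal B\subseteq\mathcal D'(M)$ with continuous inclusions, the first one with dense image; the operators $\mathcal L_t$, $t\ge0$, form a strongly continuous semigroup of bounded operators on $\mathcal B$, with generator $X$; the spectrum of $X$ on $\mathcal B$ in $\{\operatorname{Re}z>-A\}$ consists of isolated eigenvalues of finite algebraic multiplicity; and $\lambda$ is an eigenvalue of $X$ on $\mathcal B$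 of algebraic multiplicity $m$. Sums over resonances count multiplicity. *Periodic orbits.* For a periodic orbit $\gamma$ of the flow (multiple coverings of closed trajectories are included), let $T_\gamma>0$ be its length, $T_\gamma^\#$ its primitive length, $\int_\gamma g=\int_0^{T_\gamma}g(\phi^\tau x)\,d\tau$ for $x\in\gamma$, and $\mathcal P_\gamma$ its linearized Poincaré map, that is, the endomorphism of $E^u_x\oplus E^s_x$ induced by $D_x\phi^{T_\gamma}$. For $\operatorname{Re}s$ large, where the series converges absolutely, the *dynamical determinant* is $$d_g(s)=\exp\left(-\sum_\gamma\frac{T_\gamma^\#}{T_\gamma}\,e^{\int_\gamma g}\,\frac{e^{-sT_\gamma}}{|\det(I-\mathcal P_\gamma)|}\right).$$ *Trace formula.* The trace formula is said to hold if, as distributions on $(0,+\infty)$, $$\sum_{\lambda}e^{\lambda t}=\sum_\gamma\frac{T_\gamma^\#\,e^{\int_\gamma g}}{|\det(I-\mathcal P_\gamma)|}\,\delta_{T_\gamma},$$ where $\lambda$ runs over the Ruelle resonances of $X$; that is, for every $h\in C_c^\infty((0,+\infty))$ the sums obtained by testing both sides against $h$ converge (unconditionally) and are equal. **Corollary.**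 Suppose that the trace formula holds. 1. If there is $\rho\in[0,\tfrac12)$ such that $\sum_{\lambda}\frac{1}{1+|\lambda|^{\rho}}<\infty$, the sum running over the Ruelle resonances of $X$, then $d_g$ is constant equal to one, and $X$ has no Ruelle resonances. 2. If $g$ is real-valued, the same conclusion holds as soon as there is $\rho\in[0,1)$ such that $\sum_{\lambda}\frac{1}{1+|\lambda|^{\rho}}<\infty$. -/

import Mathlib

open Set Filter Topology MeasureTheory
open scoped Manifold ContDiff

universe u

noncomputable section

namespace Ruelle

variable {d : ℕ} {M : Type u} [TopologicalSpace M] [ChartedSpace (EuclideanSpace ℝ (Fin (d + 1))) M]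

section Flows

/-! ### Anosov flows and their periodic orbits -/

/-- A linear map `T_x M → T_y M` with `y = x`, seen as an endomorphism of `T_x M`. -/
def endOfEq {x y : M} (h : y = x)
    (L : TangentSpace (𝓡 (d + 1)) x →ₗ[ℝ] TangentSpace (𝓡 (d + 1)) y) :
    TangentSpace (𝓡 (d + 1)) x →ₗ[ℝ] TangentSpace (𝓡 (d + 1)) x :=
  cast (by rw [h]) L

lemma map_endOfEq {x y : M} (h : y = x)
    (L : TangentSpace (𝓡 (d + 1)) x →ₗ[ℝ] TangentSpace (𝓡 (d + 1)) y)
    (E : ∀ x : M, Submodule ℝ (TangentSpace (𝓡 (d + 1)) x)) (hE : (E x).map L = E y) :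
    (E x).map (endOfEq h L) = E x := by
  subst h
  exact hE

variable [IsManifold (𝓡 (d + 1)) ∞ M]

variable (d M) in
/-- A smooth Anosov flow on `M`, with its generating vector field and its hyperbolic splitting
`T_x M = E^u_x ⊕ E^s_x ⊕ ℝ V(x)`, the last summand being a line.
(The splitting is determined by the flow.) -/
structure AnosovFlow where
  /-- the generating vector field -/
  V : ∀ x : M, TangentSpace (𝓡 (d + 1)) x
  smooth_V : ContMDiff (𝓡 (d + 1)) (𝓡 (d + 1)).tangent ∞
    (fun x => (⟨x, V x⟩ : TangentBundle (𝓡 (d + 1)) M))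
  /-- the flow `φ^t` -/
  flow : Flow ℝ M
  smooth_flow : ContMDiff (𝓘(ℝ, ℝ).prod (𝓡 (d + 1))) (𝓡 (d + 1)) ∞
    (fun p : ℝ × M => flow p.1 p.2)
  integralCurve : ∀ x, IsMIntegralCurve (I := 𝓡 (d + 1)) (fun t => flow t x) V
  V_ne_zero : ∀ x, V x ≠ 0
  /-- the unstable subspaces -/
  Eu : ∀ x : M, Submodule ℝ (TangentSpace (𝓡 (d + 1)) x)
  /-- the stable subspaces -/
  Es : ∀ x : M, Submodule ℝ (TangentSpace (𝓡 (d + 1)) x)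
  disjoint : ∀ x, Disjoint (Eu x) (Es x)
  isCompl : ∀ x, IsCompl (Eu x ⊔ Es x) (Submodule.span ℝ {V x})
  map_Eu : ∀ (t : ℝ) (x : M),
    (Eu x).map (mfderiv (𝓡 (d + 1)) (𝓡 (d + 1)) (flow t) x).toLinearMap = Eu (flow t x)
  map_Es : ∀ (t : ℝ) (x : M),
    (Es x).map (mfderiv (𝓡 (d + 1)) (𝓡 (d + 1)) (flow t) x).toLinearMap = Es (flow t x)
  hyperbolic : ∃ (ρ : Bundle.ContMDiffRiemannianMetric (𝓡 (d + 1)) ∞ (EuclideanSpace ℝ (Fin (d + 1)))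
      (fun x : M => TangentSpace (𝓡 (d + 1)) x)) (C θ : ℝ), 0 < C ∧ 0 < θ ∧ θ < 1 ∧
    ∀ (t : ℝ), 0 ≤ t → ∀ x : M,
      (∀ v ∈ Es x,
        √(ρ.inner (flow t x) (mfderiv (𝓡 (d + 1)) (𝓡 (d + 1)) (flow t) x v)
          (mfderiv (𝓡 (d + 1)) (𝓡 (d + 1)) (flow t) x v)) ≤ C * θ ^ t * √(ρ.inner x v v)) ∧
      (∀ v ∈ Eu x,
        √(ρ.inner (flow (-t) x) (mfderiv (𝓡 (d + 1)) (𝓡 (d + 1)) (flow (-t)) x v)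
          (mfderiv (𝓡 (d + 1)) (𝓡 (d + 1)) (flow (-t)) x v)) ≤ C * θ ^ t * √(ρ.inner x v v))

namespace AnosovFlow

variable (F : AnosovFlow d M)

/-- The derivative `D_x φ^T : T_x M → T_x M` at a point `x` with `φ^T(x) = x`. -/
def returnDeriv (T : ℝ) (x : M) (h : F.flow T x = x) :
    TangentSpace (𝓡 (d + 1)) x →ₗ[ℝ] TangentSpace (𝓡 (d + 1)) x :=
  endOfEq h (mfderiv (𝓡 (d + 1)) (𝓡 (d + 1)) (F.flow T) x).toLinearMap

lemma returnDeriv_mem (T : ℝ) (x : M) (h : F.flow T x = x) :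
    ∀ v ∈ F.Eu x ⊔ F.Es x, F.returnDeriv T x h v ∈ F.Eu x ⊔ F.Es x := by
  intro v hv
  have key : (F.Eu x ⊔ F.Es x).map (F.returnDeriv T x h) = F.Eu x ⊔ F.Es x := by
    rw [Submodule.map_sup]
    exact congrArg₂ _ (map_endOfEq h _ F.Eu (F.map_Eu T x)) (map_endOfEq h _ F.Es (F.map_Es T x))
  rw [← key]
  exact Submodule.mem_map_of_mem hv

/-- The linearized Poincaré map: the endomorphism of `E^u_x ⊕ E^s_x` induced by `D_x φ^T`,
where `φ^T(x) = x`. -/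
def poincareMap (T : ℝ) (x : M) (h : F.flow T x = x) :
    (F.Eu x ⊔ F.Es x : Submodule ℝ (TangentSpace (𝓡 (d + 1)) x)) →ₗ[ℝ]
      (F.Eu x ⊔ F.Es x : Submodule ℝ (TangentSpace (𝓡 (d + 1)) x)) :=
  (F.returnDeriv T x h).restrict (F.returnDeriv_mem T x h)

/-- A periodic orbit: the image of a closed trajectory together with a length `T > 0`, which is
any positive period (so a closed trajectory run through several times counts once for every
number of turns). -/
structure PeriodicOrbit where
  image : Set M
  length : ℝ
  length_pos : 0 < length
  exists_base : ∃ x, image = range (fun t => F.flow t x) ∧ F.flow length x = x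

namespace PeriodicOrbit

variable {F} (γ : F.PeriodicOrbit)

/-- A point of the orbit. -/
def base : M := γ.exists_base.choose

lemma flow_base : F.flow γ.length γ.base = γ.base := γ.exists_base.choose_spec.2

/-- The length of the shortest periodic orbit with the same image. -/
def primitiveLength : ℝ := sInf {T | ∃ γ' : F.PeriodicOrbit, γ'.image = γ.image ∧ γ'.length = T}

/-- The integral of the potential along the orbit. -/
def integral (g : M → ℂ) : ℂ := ∫ t in (0 : ℝ)..γ.length, g (F.flow t γ.base)

/-- `|det (I - P_γ)|`. -/
def absDet : ℝ := |LinearMap.det (LinearMap.id - F.poincareMap γ.length γ.base γ.flow_base)|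

end PeriodicOrbit

/-- The term of the orbit `γ` in the series that defines the dynamical determinant. -/
def detTerm (g : M → ℂ) (s : ℂ) (γ : F.PeriodicOrbit) : ℂ :=
  (γ.primitiveLength / γ.length : ℝ) * Complex.exp (γ.integral g) *
    (Complex.exp (-s * γ.length) / γ.absDet)

/-- The dynamical determinant `d_g(s)`, at the points `s` where its series converges. -/
def dynamicalDeterminant (g : M → ℂ) (s : ℂ) : ℂ := Complex.exp (-∑' γ, F.detTerm g s γ)

/-- The weight of the orbit `γ` in the trace formula. -/
def traceWeight (g : M → ℂ) (γ : F.PeriodicOrbit) : ℂ :=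
  γ.primitiveLength * Complex.exp (γ.integral g) / γ.absDet

/-- The Koopman operator on functions,
`L_t f (x) = exp (∫_0^t g(φ^τ x) dτ) f(φ^t x)`. -/
def koopman (g : M → ℂ) (t : ℝ) (f : M → ℂ) (x : M) : ℂ :=
  Complex.exp (∫ τ in (0 : ℝ)..t, g (F.flow τ x)) * f (F.flow t x)

/-- The operator `X = V + g` on smooth functions. -/
def generator (g : M → ℂ) (f : M → ℂ) (x : M) : ℂ :=
  let Vf : ℂ := mfderiv (𝓡 (d + 1)) 𝓘(ℝ, ℂ) f x (F.V x)
  Vf + g x * f x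

end AnosovFlow

end Flows

section Distributions

/-! ### Smooth functions, smooth densities and distributions -/

variable (d M)

/-- The complex vector space of smooth functions `M → ℂ`. -/
def smoothSubmodule : Submodule ℂ (M → ℂ) where
  carrier := {f | ContMDiff (𝓡 (d + 1)) 𝓘(ℝ, ℂ) ∞ f}
  add_mem' hf hg := ContMDiff.add hf hg
  zero_mem' := contMDiff_const
  smul_mem' c f hf := by
    have h : ContDiff ℝ ∞ (fun z : ℂ => c * z) := contDiff_const.mul contDiff_id
    exact h.contMDiff.comp hf

/-- The space `C^∞(M)` of complex-valued smooth functions. -/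
def SmoothFun : Type u := smoothSubmodule d M

instance : AddCommGroup (SmoothFun d M) := inferInstanceAs (AddCommGroup (smoothSubmodule d M))

instance : Module ℂ (SmoothFun d M) := inferInstanceAs (Module ℂ (smoothSubmodule d M))

instance : CoeFun (SmoothFun d M) (fun _ => M → ℂ) := ⟨Subtype.val⟩

/-- The Fréchet topology of `C^∞(M)`: locally uniform convergence of all the derivatives, in every
chart. -/
instance : TopologicalSpace (SmoothFun d M) :=
  ⨅ (e : IsManifold.maximalAtlas (𝓡 (d + 1)) ∞ M) (k : ℕ), TopologicalSpace.induced
    (fun f : SmoothFun d M => UniformOnFun.ofFun {K | IsCompact K ∧ K ⊆ e.1.target}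
      (iteratedFDeriv ℝ k (fun y => f (e.1.symm y)))) inferInstance

variable [MeasurableSpace M] [BorelSpace M]

variable {M} in
/-- `ρ` is the smooth density of the complex measure `μ`, with respect to Lebesgue measure,
in the chart `e`. -/
structure IsChartDensity (μ : ComplexMeasure M)
    (e : OpenPartialHomeomorph M (EuclideanSpace ℝ (Fin (d + 1))))
    (ρ : EuclideanSpace ℝ (Fin (d + 1)) → ℂ) : Prop where
  smooth : ContDiffOn ℝ ∞ ρ e.target
  integrable : IntegrableOn ρ e.target
  eq_integral : ∀ s ⊆ e.target, MeasurableSet s → μ (e.symm '' s) = ∫ y in s, ρ y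

/-- The smooth densities: complex measures with a smooth density in every smooth chart. -/
def densitySubmodule : Submodule ℂ (ComplexMeasure M) where
  carrier := {μ | ∀ e ∈ IsManifold.maximalAtlas (𝓡 (d + 1)) ∞ M, ∃ ρ, IsChartDensity d μ e ρ}
  add_mem' := by
    intro μ ν hμ hν e he
    obtain ⟨ρ, h⟩ := hμ e he
    obtain ⟨σ, h'⟩ := hν e he
    refine ⟨fun y => ρ y + σ y, h.smooth.add h'.smooth, h.integrable.add h'.integrable, ?_⟩
    intro s hs hm
    rw [integral_add (h.integrable.mono_set hs) (h'.integrable.mono_set hs),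
      ← h.eq_integral s hs hm, ← h'.eq_integral s hs hm]
    rfl
  zero_mem' := by
    intro e he
    refine ⟨fun _ => 0, contDiffOn_const, integrable_zero _ _ _, ?_⟩
    intro s hs hm
    simp
  smul_mem' := by
    intro c μ hμ e he
    obtain ⟨ρ, h⟩ := hμ e he
    refine ⟨fun y => c * ρ y, contDiffOn_const.mul h.smooth, h.integrable.const_mul c, ?_⟩
    intro s hs hm
    rw [integral_const_mul, ← h.eq_integral s hs hm]
    rfl

/-- The space `D(M)` of smooth complex densities on `M`. -/
def Density : Type u := densitySubmodule d M

instance : AddCommGroup (Density d M) := inferInstanceAs (AddCommGroup (densitySubmodule d M))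

instance : Module ℂ (Density d M) := inferInstanceAs (Module ℂ (densitySubmodule d M))

variable {d M}

/-- The density of `μ` in the chart `e`. -/
def Density.inChart (μ : Density d M) (e : IsManifold.maximalAtlas (𝓡 (d + 1)) ∞ M) :
    EuclideanSpace ℝ (Fin (d + 1)) → ℂ :=
  (μ.2 e.1 e.2).choose

/-- The integral `∫ f dμ` of a function against a smooth density. -/
def Density.pair (μ : Density d M) (f : M → ℂ) : ℂ :=
  VectorMeasure.integral (μ.1 : ComplexMeasure M) f (ContinuousLinearMap.mul ℝ ℂ)

/-- The Fréchet topology of `D(M)`: locally uniform convergence of all the derivatives of the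
densities, in every chart. -/
instance : TopologicalSpace (Density d M) :=
  ⨅ (e : IsManifold.maximalAtlas (𝓡 (d + 1)) ∞ M) (k : ℕ), TopologicalSpace.induced
    (fun μ : Density d M => UniformOnFun.ofFun {K | IsCompact K ∧ K ⊆ e.1.target}
      (iteratedFDeriv ℝ k (μ.inChart e))) inferInstance

variable (d M) in
/-- The space `D'(M)` of distributions: the continuous linear functionals on `D(M)`. -/
abbrev Distribution : Type u := Density d M →L[ℂ] ℂ

/-- `w = A u`, where the operator `A` on `D'(M)` is the transpose of the formal adjoint of an
operator `A` on functions: `⟨A u, μ⟩ = ⟨u, A^* μ⟩`, with `A^* μ` the (unique) smooth density such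
that `∫ f d(A^* μ) = ∫ A f dμ` for all smooth functions `f`. -/
def IsImageUnder (A : (M → ℂ) → (M → ℂ)) (u w : Distribution d M) : Prop :=
  ∀ μ : Density d M, ∃ ν : Density d M,
    (∀ f : SmoothFun d M, ν.pair f = μ.pair (A f)) ∧ w μ = u ν

end Distributions

section Spectrum

/-! ### Unbounded operators, given by their graph -/

variable {B : Type u} [NormedAddCommGroup B] [NormedSpace ℂ B]

/-- The graph of the generator of a semigroup: `b` is in the domain and is mapped to `c`. -/
def IsGenerator (S : ℝ → B →L[ℂ] B) (b c : B) : Prop :=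
  Tendsto (fun t : ℝ => (t : ℂ)⁻¹ • (S t b - b)) (𝓝[>] 0) (𝓝 c)

/-- `R` is the bounded inverse of `z - X`, where `X` is the operator with graph `G`. -/
def IsResolvent (G : B → B → Prop) (z : ℂ) (R : B →L[ℂ] B) : Prop :=
  (∀ b, G (R b) (z • R b - b)) ∧ ∀ b c, G b c → R (z • b - c) = b

/-- The spectrum: the numbers `z` such that `z - X` has no bounded inverse. -/
def operatorSpectrum (G : B → B → Prop) : Set ℂ := {z | ¬ ∃ R, IsResolvent G z R}

open Classical in
/-- The resolvent `(z - X)⁻¹` (and `0` on the spectrum). -/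
def resolventAt (G : B → B → Prop) (z : ℂ) : B →L[ℂ] B :=
  if h : ∃ R, IsResolvent G z R then h.choose else 0

/-- `(2πi)⁻¹ ∮ (z - X)⁻¹ dz` over the circle of centre `z₀` and radius `r`. -/
def spectralProjector (G : B → B → Prop) (z₀ : ℂ) (r : ℝ) : B →L[ℂ] B :=
  (2 * Real.pi * Complex.I : ℂ)⁻¹ • ∮ z in C(z₀, r), resolventAt G z

/-- `z₀` is an isolated eigenvalue of finite algebraic multiplicity `m`: it is an isolated point of
the spectrum and the spectral projector has rank `m`. -/
def IsIsolatedEigenvalue (G : B → B → Prop) (z₀ : ℂ) (m : ℕ) : Prop :=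
  z₀ ∈ operatorSpectrum G ∧ ∃ r > 0, operatorSpectrum G ∩ Metric.closedBall z₀ r = {z₀} ∧
    FiniteDimensional ℂ (spectralProjector G z₀ r).range ∧
    Module.finrank ℂ (spectralProjector G z₀ r).range = m

end Spectrum

section Resonances

/-! ### Ruelle resonances and the trace formula -/

variable [IsManifold (𝓡 (d + 1)) ∞ M] [MeasurableSpace M] [BorelSpace M]

/-- A Banach space `B` with `C^∞(M) ⊆ B ⊆ D'(M)` (continuous inclusions, the first one dense) on
which the Koopman operators form a strongly continuous semigroup of bounded operators, whose
generator `X = V + g` has only isolated eigenvalues of finite multiplicity in `Re z > -A`. -/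
structure AnisotropicSpace (F : AnosovFlow d M) (g : M → ℂ) (A : ℝ)
    (B : Type u) [NormedAddCommGroup B] [NormedSpace ℂ B] where
  /-- the inclusion of `C^∞(M)` in `B` -/
  ofSmooth : SmoothFun d M →L[ℂ] B
  denseRange_ofSmooth : DenseRange ofSmooth
  /-- the inclusion of `B` in `D'(M)` -/
  toDistribution : B →ₗ[ℂ] Distribution d M
  injective_toDistribution : Function.Injective toDistribution
  /-- For linear maps from a Banach space, continuity to the weak-* topology and to the strong
  topology of `D'(M)` are equivalent. -/
  continuous_toDistribution : ∀ μ : Density d M, Continuous (fun b => toDistribution b μ)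
  toDistribution_ofSmooth : ∀ (f : SmoothFun d M) (μ : Density d M),
    toDistribution (ofSmooth f) μ = μ.pair f
  /-- the operators `L_t` on `B`, for `t ≥ 0` -/
  S : ℝ → B →L[ℂ] B
  S_koopman : ∀ t ≥ 0, ∀ b, IsImageUnder (F.koopman g t) (toDistribution b) (toDistribution (S t b))
  S_zero : S 0 = 1
  S_add : ∀ s ≥ 0, ∀ t ≥ 0, S (s + t) = S s * S t
  S_continuous : ∀ b, ContinuousOn (fun t => S t b) (Ici 0)
  /-- The generator is `X`, with domain `{b ∈ B : X b ∈ B}`. -/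
  isGenerator_iff : ∀ b c, IsGenerator S b c ↔
    IsImageUnder (F.generator g) (toDistribution b) (toDistribution c)
  discrete : ∀ z ∈ operatorSpectrum (IsGenerator S), -A < z.re →
    ∃ m, IsIsolatedEigenvalue (IsGenerator S) z m

/-- `z` is a Ruelle resonance of `X = V + g` of multiplicity `m`. -/
def IsResonance (F : AnosovFlow d M) (g : M → ℂ) (z : ℂ) (m : ℕ) : Prop :=
  0 < m ∧ ∃ A > 0, -A < z.re ∧
    ∃ (B : Type u) (_ : NormedAddCommGroup B) (_ : NormedSpace ℂ B) (_ : CompleteSpace B)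
      (𝓑 : AnisotropicSpace F g A B), IsIsolatedEigenvalue (IsGenerator 𝓑.S) z m

/-- The Ruelle resonances, each one together with its multiplicity. (The multiplicity is determined
by the resonance.) -/
def Resonance (F : AnosovFlow d M) (g : M → ℂ) : Type :=
  {p : ℂ × ℕ // IsResonance F g p.1 p.2}

/-- The resonance as a complex number. -/
def Resonance.value {F : AnosovFlow d M} {g : M → ℂ} (p : Resonance F g) : ℂ := p.1.1

/-- The multiplicity of the resonance. -/
def Resonance.mult {F : AnosovFlow d M} {g : M → ℂ} (p : Resonance F g) : ℕ := p.1.2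

/-- The trace formula `∑_λ e^{λ t} = ∑_γ T_γ^# e^{∫_γ g} / |det(I - P_γ)| δ_{T_γ}`, as an equality
between distributions on `(0, ∞)`, resonances being counted with multiplicity. -/
def TraceFormula (F : AnosovFlow d M) (g : M → ℂ) : Prop :=
  ∀ h : ℝ → ℂ, ContDiff ℝ ∞ h → HasCompactSupport h → tsupport h ⊆ Ioi 0 →
    ∃ S : ℂ,
      HasSum (fun p : Resonance F g => (p.mult : ℂ) * ∫ t : ℝ, Complex.exp (p.value * t) * h t) S ∧
      HasSum (fun γ : F.PeriodicOrbit => F.traceWeight g γ * h γ.length) S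

/-- `∑_λ 1 / (1 + |λ|^ρ) < ∞`, the sum running over the resonances counted with multiplicity. -/
def ResonanceSumFinite (F : AnosovFlow d M) (g : M → ℂ) (ρ : ℝ) : Prop :=
  Summable (fun p : Resonance F g => (p.mult : ℝ) * (1 / (1 + ‖p.value‖ ^ ρ)))

/-- The series of the dynamical determinant converges absolutely for `Re s` large, and there
`d_g(s) = 1`; that is, `d_g` and its holomorphic continuation are constant equal to one. -/
def DeterminantEqOne (F : AnosovFlow d M) (g : M → ℂ) : Prop :=
  ∃ σ : ℝ, ∀ s : ℂ, σ < s.re → Summable (F.detTerm g s) ∧ F.dynamicalDeterminant g s = 1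

end Resonances

end Ruelle

end

/-! The geometric side of the trace formula sees nothing below the shortest period, while a sparse
spectral side can be tested against a single resonance. On a compact manifold the periods are
bounded below by some T > 0 (`exists_pos_le_of_flow_eq_of_immersion`). If the resonances satisfy the
summability condition with an exponent ρ < 1, then for each resonance z₀ there is a test function
supported in (0, T) whose Laplace transform vanishes at every resonance except z₀
(`exists_testFunction`). The trace formula then says that the total multiplicity at z₀ is zero, so
there are no resonances (`isEmpty_resonance`).

The test function is an infinite convolution of a smooth bump with two-point measures (1 - w) δ_0 +
w δ_b. Each multiplies the Laplace transform by (1 - w) + w e^{zb}, which is made to vanish at one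
resonance. Sparseness makes the shifts b summable, so that the support stays short, and keeps the
total variations close enough to 1 for their product to converge (`exists_twoPoint_vanishing`,
`exists_exp_bound`, `exists_limit_iterTwoPoint`). The finitely many small resonances are removed by
first-order differential operators.

Without resonances the geometric side is the zero distribution. Shrinking bumps show that the
weights of the orbits of each length sum to zero (`tsum_traceWeight_eq_zero`), and grouping the
series of the determinant by length gives d_g = 1 wherever it converges absolutely.

Absolute convergence in a half-plane needs two consequences of hyperbolicity: at most exponentially
many periodic orbits (`exists_card_periodicOrbit_le`), and a lower bound on |det(I - P_γ)| for long
orbits (`exists_one_le_absDet`). The count rests on expansivity (`exists_expansivity`), proved by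
linearization: a sequence of pairs of distinct closed orbits shadowing each other would produce in
the limit a tangent vector that is transverse to the flow, yet bounded modulo the flow direction for
all times, which the hyperbolic splitting forbids. Distances are measured through an embedding in
Euclidean space. -/

namespace Ruelle

section TestFunctions

/-! ### Test functions whose Laplace transform vanishes on a sparse set -/

/-- The two-sided Laplace transform, with the sign convention of the trace formula. -/
noncomputable def laplace (h : ℝ → ℂ) (z : ℂ) : ℂ := ∫ t : ℝ, Complex.exp (z * t) * h t

/-- Convolution of `f` with the measure `(1 - w) δ_0 + w δ_b`. -/
def twoPoint (b : ℝ) (w : ℂ) (f : ℝ → ℂ) : ℝ → ℂ := fun t => (1 - w) * f t + w * f (t - b)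

/-- Successive convolutions of `f` with the measures `(1 - w k) δ_0 + w k δ_{b k}`. -/
def iterTwoPoint (b : ℕ → ℝ) (w : ℕ → ℂ) (f : ℝ → ℂ) : ℕ → ℝ → ℂ
  | 0 => f
  | n + 1 => twoPoint (b n) (w n) (iterTwoPoint b w f n)

lemma contDiff_twoPoint {f : ℝ → ℂ} (hf : ContDiff ℝ ∞ f) (b : ℝ) (w : ℂ) :
    ContDiff ℝ ∞ (twoPoint b w f) := by
  have h1 : ContDiff ℝ ∞ (fun t => f (t - b)) := hf.comp (contDiff_id.sub contDiff_const)
  exact (contDiff_const.mul hf).add (contDiff_const.mul h1)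

lemma contDiff_iterTwoPoint {f : ℝ → ℂ} (hf : ContDiff ℝ ∞ f) (b : ℕ → ℝ) (w : ℕ → ℂ) (n : ℕ) :
    ContDiff ℝ ∞ (iterTwoPoint b w f n) := by
  induction n with
  | zero => exact hf
  | succ n ih => exact contDiff_twoPoint ih _ _

lemma iteratedDeriv_twoPoint {f : ℝ → ℂ} (hf : ContDiff ℝ ∞ f) (b : ℝ) (w : ℂ) (k : ℕ) (t : ℝ) :
    iteratedDeriv k (twoPoint b w f) t =
      (1 - w) * iteratedDeriv k f t + w * iteratedDeriv k f (t - b) := by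
  have hfk : ContDiff ℝ k f := hf.of_le (by exact_mod_cast le_top)
  have h1 : ContDiff ℝ k (fun t => f (t - b)) := hfk.comp (contDiff_id.sub contDiff_const)
  have : twoPoint b w f = (fun t => (1 - w) * f t) + fun t => w * f (t - b) := rfl
  rw [this, iteratedDeriv_add (contDiff_const.mul hfk).contDiffAt
    (contDiff_const.mul h1).contDiffAt, iteratedDeriv_const_mul _ hfk.contDiffAt,
    iteratedDeriv_const_mul _ h1.contDiffAt, iteratedDeriv_comp_sub_const]

/-- Convolution commutes with derivatives and costs at most the total variation of the measure, here
bounded by ∏ (1 + s i) ≤ exp (∑ s i). The bound is uniform in the number of convolutions. -/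
lemma norm_iteratedDeriv_iterTwoPoint_le {f : ℝ → ℂ} (hf : ContDiff ℝ ∞ f) {b : ℕ → ℝ} {w : ℕ → ℂ}
    {s : ℕ → ℝ} (hs0 : ∀ n, 0 ≤ s n) (hs : Summable s) (hw : ∀ n, ‖1 - w n‖ + ‖w n‖ ≤ 1 + s n)
    {k : ℕ} {C : ℝ} (hC : ∀ t, ‖iteratedDeriv k f t‖ ≤ C) (n : ℕ) (t : ℝ) :
    ‖iteratedDeriv k (iterTwoPoint b w f n) t‖ ≤ Real.exp (∑' i, s i) * C := by
  have hC0 : 0 ≤ C := (norm_nonneg _).trans (hC 0)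
  have key : ∀ n t, ‖iteratedDeriv k (iterTwoPoint b w f n) t‖ ≤
      Real.exp (∑ i ∈ Finset.range n, s i) * C := by
    intro n
    induction n with
    | zero => intro t; simpa [iterTwoPoint] using hC t
    | succ n ih =>
      intro t
      rw [iterTwoPoint, iteratedDeriv_twoPoint (contDiff_iterTwoPoint hf b w n)]
      have hE : 0 ≤ Real.exp (∑ i ∈ Finset.range n, s i) * C := by positivity
      calc _ ≤ ‖1 - w n‖ * (Real.exp (∑ i ∈ Finset.range n, s i) * C) +
            ‖w n‖ * (Real.exp (∑ i ∈ Finset.range n, s i) * C) := by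
            refine (norm_add_le _ _).trans ?_
            rw [norm_mul, norm_mul]
            gcongr
            · exact ih t
            · exact ih _
        _ = (‖1 - w n‖ + ‖w n‖) * (Real.exp (∑ i ∈ Finset.range n, s i) * C) := by ring
        _ ≤ Real.exp (s n) * (Real.exp (∑ i ∈ Finset.range n, s i) * C) := by
            gcongr
            linarith [hw n, Real.add_one_le_exp (s n)]
        _ = _ := by rw [Finset.sum_range_succ, Real.exp_add]; ring
  refine (key n t).trans ?_
  gcongr
  exact hs.sum_le_tsum _ (fun i _ => hs0 i)

/-- Every shift moves the support to the right, so only its right end moves, by at most the sum of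
all shifts. -/
lemma iterTwoPoint_eq_zero {f : ℝ → ℂ} {α β : ℝ} (hf : ∀ t, t ∉ Icc α β → f t = 0)
    {b : ℕ → ℝ} {w : ℕ → ℂ} (hb0 : ∀ n, 0 ≤ b n) (hb : Summable b) (n : ℕ) (t : ℝ)
    (ht : t ∉ Icc α (β + ∑' i, b i)) : iterTwoPoint b w f n t = 0 := by
  have key : ∀ n t, t ∉ Icc α (β + ∑ i ∈ Finset.range n, b i) → iterTwoPoint b w f n t = 0 := by
    intro n
    induction n with
    | zero => intro t ht; exact hf t (by simpa using ht)
    | succ n ih =>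
      intro t ht
      rw [Finset.sum_range_succ] at ht
      have h1 : t ∉ Icc α (β + ∑ i ∈ Finset.range n, b i) := fun h =>
        ht ⟨h.1, h.2.trans (by linarith [hb0 n])⟩
      have h2 : t - b n ∉ Icc α (β + ∑ i ∈ Finset.range n, b i) := fun h =>
        ht ⟨by linarith [h.1, hb0 n], by linarith [h.2]⟩
      simp [iterTwoPoint, twoPoint, ih _ h1, ih _ h2]
  refine key n t fun h => ht ⟨h.1, h.2.trans ?_⟩
  gcongr
  exact hb.sum_le_tsum _ (fun i _ => hb0 i)

lemma integrable_exp_mul {f : ℝ → ℂ} (hf : Continuous f) (hc : HasCompactSupport f) (z : ℂ) :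
    Integrable (fun t : ℝ => Complex.exp (z * t) * f t) :=
  Continuous.integrable_of_hasCompactSupport (by fun_prop) hc.mul_left

lemma laplace_twoPoint {f : ℝ → ℂ} (hf : Continuous f) (hc : HasCompactSupport f) (b : ℝ) (w z : ℂ) :
    laplace (twoPoint b w f) z = ((1 - w) + w * Complex.exp (z * b)) * laplace f z := by
  have h1 := integrable_exp_mul hf hc z
  have h2 : (fun t : ℝ => Complex.exp (z * t) * f (t - b)) =
      fun t : ℝ => Complex.exp (z * b) * (Complex.exp (z * (t - b : ℝ)) * f (t - b)) := by
    ext t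
    rw [← mul_assoc, ← Complex.exp_add]
    congr 2
    push_cast
    ring
  have h3 : Integrable (fun t : ℝ => Complex.exp (z * t) * f (t - b)) := by
    rw [h2]
    exact (h1.comp_sub_right b).const_mul _
  have h4 : ∫ t : ℝ, Complex.exp (z * t) * f (t - b) = Complex.exp (z * b) * laplace f z := by
    rw [h2, integral_const_mul]
    congr 1
    exact integral_sub_right_eq_self (fun t : ℝ => Complex.exp (z * t) * f t) b
  calc laplace (twoPoint b w f) z
      = ∫ t : ℝ, ((1 - w) * (Complex.exp (z * t) * f t) + w * (Complex.exp (z * t) * f (t - b))) := by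
        refine integral_congr_ae (.of_forall fun t => ?_)
        simp only [twoPoint]
        ring
    _ = _ := by
        rw [integral_add (h1.const_mul _) (h3.const_mul _), integral_const_mul, integral_const_mul, h4,
          laplace]
        ring

lemma hasCompactSupport_of_eq_zero {f : ℝ → ℂ} {α β : ℝ} (hf : ∀ t, t ∉ Icc α β → f t = 0) :
    HasCompactSupport f := HasCompactSupport.intro isCompact_Icc hf

lemma tsupport_subset_of_eq_zero {f : ℝ → ℂ} {α β : ℝ} (hf : ∀ t, t ∉ Icc α β → f t = 0) :
    tsupport f ⊆ Icc α β :=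
  closure_minimal (fun t ht => by_contra fun h => ht (hf t h)) isClosed_Icc

/-- The infinite convolution of a test function with two-point measures is a test function. -/
theorem exists_limit_iterTwoPoint {f : ℝ → ℂ} (hf : ContDiff ℝ ∞ f) {α β : ℝ}
    (hfs : ∀ t, t ∉ Icc α β → f t = 0) {b : ℕ → ℝ} {w : ℕ → ℂ} {s : ℕ → ℝ} (hb0 : ∀ n, 0 ≤ b n)
    (hb : Summable b) (hs0 : ∀ n, 0 ≤ s n) (hs : Summable s)
    (hw : ∀ n, ‖1 - w n‖ + ‖w n‖ ≤ 1 + s n) (hw2 : ∀ n, ‖w n‖ ≤ 2) :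
    ∃ h : ℝ → ℂ, ContDiff ℝ ∞ h ∧ (∀ t, t ∉ Icc α (β + ∑' i, b i) → h t = 0) ∧
      ∀ z, Tendsto (fun n => (∏ k ∈ Finset.range n, ((1 - w k) + w k * Complex.exp (z * b k))) *
        laplace f z) atTop (𝓝 (laplace h z)) := by
  have hfc : HasCompactSupport f := hasCompactSupport_of_eq_zero hfs
  set H := iterTwoPoint b w f with hH
  have hHd : ∀ n, ContDiff ℝ ∞ (H n) := contDiff_iterTwoPoint hf b w
  have hbd : ∀ k, ∃ C, ∀ t, ‖iteratedDeriv k f t‖ ≤ C := by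
    intro k
    have hk : HasCompactSupport (iteratedDeriv k f) := by
      induction k with
      | zero => simpa using hfc
      | succ k ih => rw [iteratedDeriv_succ]; exact ih.deriv
    exact hk.exists_bound_of_continuous
      (hf.continuous_iteratedDeriv k (by exact_mod_cast le_top))
  choose C hC using hbd
  set D : ℕ → ℝ := fun k => Real.exp (∑' i, s i) * C k with hD
  have hHD : ∀ k n t, ‖iteratedDeriv k (H n) t‖ ≤ D k := fun k n t =>
    norm_iteratedDeriv_iterTwoPoint_le hf hs0 hs hw (hC k) n t
  have hHz : ∀ n t, t ∉ Icc α (β + ∑' i, b i) → H n t = 0 := iterTwoPoint_eq_zero hfs hb0 hb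
  -- The limit is written as a telescoping series. One increment is `w n` times a difference of
  -- translates by `b n`, so the mean value theorem bounds its k-th derivative by a bound on the
  -- derivative of order k + 1, times `b n`; this is summable for every k.
  set δ : ℕ → ℝ → ℂ := fun n t => H (n + 1) t - H n t with hδ
  have hδd : ∀ n, ContDiff ℝ ∞ (δ n) := fun n => (hHd _).sub (hHd _)
  have hδb : ∀ (k n : ℕ) (t : ℝ), ‖iteratedDeriv k (δ n) t‖ ≤ 2 * D (k + 1) * b n := by
    intro k n t
    have e1 : iteratedDeriv k (δ n) t =
        w n * (iteratedDeriv k (H n) (t - b n) - iteratedDeriv k (H n) t) := by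
      have h1 : ContDiff ℝ k (H (n + 1)) := (hHd _).of_le (by exact_mod_cast le_top)
      have h2 : ContDiff ℝ k (H n) := (hHd _).of_le (by exact_mod_cast le_top)
      have : δ n = H (n + 1) - H n := rfl
      rw [this, iteratedDeriv_sub h1.contDiffAt h2.contDiffAt, hH, iterTwoPoint,
        iteratedDeriv_twoPoint (contDiff_iterTwoPoint hf b w n)]
      ring
    have e2 : ‖iteratedDeriv k (H n) (t - b n) - iteratedDeriv k (H n) t‖ ≤
        D (k + 1) * ‖(t - b n) - t‖ := by
      refine Convex.norm_image_sub_le_of_norm_deriv_le (s := univ) (fun x _ => ?_) (fun x _ => ?_)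
        convex_univ (mem_univ _) (mem_univ _)
      · exact ((hHd n).differentiable_iteratedDeriv k (by exact_mod_cast ENat.natCast_lt_top k)).differentiableAt
      · rw [← iteratedDeriv_succ]
        exact hHD _ _ _
    rw [e1, norm_mul]
    have e3 : ‖(t - b n) - t‖ = b n := by
      rw [show t - b n - t = -b n by ring, norm_neg, Real.norm_of_nonneg (hb0 n)]
    rw [e3] at e2
    have := hw2 n
    calc _ ≤ 2 * (D (k + 1) * b n) := by gcongr
      _ = _ := by ring
  have hsum : ∀ t, Summable (fun n => δ n t) := fun t =>
    Summable.of_norm_bounded (hb.mul_left (2 * D 1)) fun n => by simpa using hδb 0 n t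
  refine ⟨fun t => f t + ∑' n, δ n t, ?_, ?_, ?_⟩
  · refine hf.add (contDiff_tsum (N := ⊤) (v := fun k n => 2 * D (k + 1) * b n) hδd
      (fun k _ => hb.mul_left _) ?_)
    intro k n t _
    rw [norm_iteratedFDeriv_eq_norm_iteratedDeriv]
    exact hδb k n t
  · intro t ht
    have h0 : f t = 0 := hHz 0 t ht
    simp [h0, hδ, hHz _ t ht]
  · intro z
    have hpt : ∀ t, Tendsto (fun n => H n t) atTop (𝓝 (f t + ∑' n, δ n t)) := by
      intro t
      have h1 := (hsum t).hasSum.tendsto_sum_nat.const_add (f t)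
      refine h1.congr fun n => ?_
      rw [Finset.sum_range_sub (fun n => H n t)]
      simp [hH, iterTwoPoint]
    have hlap : ∀ n, laplace (H n) z =
        (∏ k ∈ Finset.range n, ((1 - w k) + w k * Complex.exp (z * b k))) * laplace f z := by
      intro n
      induction n with
      | zero => simp [hH, iterTwoPoint]
      | succ n ih =>
        rw [hH, iterTwoPoint, laplace_twoPoint (hHd n).continuous
          (hasCompactSupport_of_eq_zero (hHz n)), Finset.prod_range_succ, ih]
        ring
    simp_rw [← hlap]
    refine tendsto_integral_of_dominated_convergence
      (fun t => (Icc α (β + ∑' i, b i)).indicator (fun t : ℝ => ‖Complex.exp (z * t)‖ * D 0) t)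
      (fun n => ?_) ?_ (fun n => ?_) (.of_forall fun t => (hpt t).const_mul _)
    · have := (hHd n).continuous
      exact Continuous.aestronglyMeasurable (by fun_prop)
    · refine (integrable_indicator_iff measurableSet_Icc).2 (Continuous.integrableOn_Icc ?_)
      fun_prop
    · refine .of_forall fun t => ?_
      by_cases ht : t ∈ Icc α (β + ∑' i, b i)
      · rw [indicator_of_mem ht, norm_mul]
        gcongr
        simpa using hHD 0 n t
      · simp [indicator_of_notMem ht, hHz n t ht]

/-- If the imaginary part of z is large, some b ≤ a makes e^{zb} a negative real number, and a
probability measure already has a zero at z. Otherwise the real part is large, e^{za} is very large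
or very small, and the complex weight 1 / (1 - e^{za}) gives a total variation close to 1. -/
lemma exists_twoPoint_vanishing (z : ℂ) {a : ℝ} (ha : 0 < a) (hL : Real.pi < a * ‖z‖) :
    ∃ b : ℝ, 0 ≤ b ∧ b ≤ a ∧ ∃ w : ℂ, (1 - w) + w * Complex.exp (z * b) = 0 ∧
      ‖1 - w‖ + ‖w‖ ≤ 1 + 2 / (Real.exp (a * ‖z‖ - Real.pi) - 1) := by
  have hu : 0 < Real.exp (a * ‖z‖ - Real.pi) - 1 := by
    have := Real.add_one_lt_exp (x := a * ‖z‖ - Real.pi) (by linarith)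
    linarith
  by_cases hy : Real.pi ≤ a * |z.im|
  · have hy0 : 0 < |z.im| := by
      by_contra h
      have : |z.im| = 0 := le_antisymm (not_lt.1 h) (abs_nonneg _)
      rw [this, mul_zero] at hy
      linarith [Real.pi_pos]
    have hb : 0 < Real.pi / |z.im| := div_pos Real.pi_pos hy0
    refine ⟨Real.pi / |z.im|, hb.le, (div_le_iff₀ hy0).2 hy, ?_⟩
    set b := Real.pi / |z.im|
    have hexp : Complex.exp (z * b) = -(Real.exp (z.re * b) : ℂ) := by
      have h1 : z * b = ((z.re * b : ℝ) : ℂ) + ((z.im * b : ℝ) : ℂ) * Complex.I := by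
        conv_lhs => rw [← Complex.re_add_im z]
        push_cast
        ring
      have h2 : Complex.exp (((z.im * b : ℝ) : ℂ) * Complex.I) = -1 := by
        rcases abs_cases z.im with ⟨h, _⟩ | ⟨h, _⟩
        · have : z.im * b = Real.pi := by
            rw [← h]; exact mul_div_cancel₀ _ hy0.ne'
          rw [this, Complex.exp_pi_mul_I]
        · have : z.im * b = -Real.pi := by
            have : |z.im| * b = Real.pi := mul_div_cancel₀ _ hy0.ne'
            rw [h] at this
            linarith
          rw [this]
          push_cast
          rw [neg_mul, Complex.exp_neg, Complex.exp_pi_mul_I]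
          norm_num
      rw [h1, Complex.exp_add, h2, Complex.ofReal_exp]
      ring
    set E := Real.exp (z.re * b) with hE
    have hE0 : 0 < E := Real.exp_pos _
    refine ⟨((1 / (1 + E) : ℝ) : ℂ), ?_, ?_⟩
    · rw [hexp]
      have : (1 + (E : ℂ)) ≠ 0 := by exact_mod_cast (by positivity : (1 + E : ℝ) ≠ 0)
      push_cast
      field_simp
      ring
    · have h1 : (1 : ℂ) - ((1 / (1 + E) : ℝ) : ℂ) = ((E / (1 + E) : ℝ) : ℂ) := by
        rw [← Complex.ofReal_one, ← Complex.ofReal_sub]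
        congr 1
        field_simp
        ring
      rw [h1, Complex.norm_real, Complex.norm_real, Real.norm_of_nonneg (by positivity),
        Real.norm_of_nonneg (by positivity), ← add_div, add_comm E 1, div_self (by positivity)]
      have := div_nonneg zero_le_two hu.le
      linarith
  · have hz : ‖z‖ ≤ |z.re| + |z.im| := Complex.norm_le_abs_re_add_abs_im z
    -- Here a |Im z| < π, so the real part carries all of a ‖z‖ except at most π.
    have hx : a * ‖z‖ - Real.pi ≤ |a * z.re| := by
      rw [abs_mul, abs_of_pos ha]
      nlinarith [mul_le_mul_of_nonneg_left hz ha.le]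
    refine ⟨a, ha.le, le_rfl, ?_⟩
    set U := Real.exp (a * ‖z‖ - Real.pi)
    set E := Complex.exp (z * a) with hE
    have hEn : ‖E‖ = Real.exp (a * z.re) := by
      rw [hE, Complex.norm_exp]
      congr 1
      simp [mul_comm]
    have hE1 : U ≤ ‖E‖ ∨ ‖E‖ * U ≤ 1 := by
      rw [hEn]
      rcases abs_cases (a * z.re) with ⟨h, _⟩ | ⟨h, _⟩
      · left
        exact Real.exp_le_exp.2 (by linarith)
      · right
        rw [← Real.exp_add]
        exact Real.exp_le_one_iff.2 (by linarith)
    have hEpos : 0 < ‖E‖ := by rw [hEn]; exact Real.exp_pos _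
    -- For w = 1 / (1 - E) the total variation is (‖E‖ + 1) / ‖1 - E‖. It is at most (U + 1) / (U -
    -- 1), the value reached at E = U and at E = 1 / U.
    have hlow : 0 < ‖1 - E‖ ∧ (‖E‖ + 1) * (U - 1) ≤ (U + 1) * ‖1 - E‖ := by
      rcases hE1 with h | h
      · have h1 : ‖E‖ - 1 ≤ ‖1 - E‖ := by
          have := norm_sub_norm_le E 1
          rwa [norm_one, norm_sub_rev] at this
        exact ⟨by linarith, by nlinarith⟩
      · have h1 : 1 - ‖E‖ ≤ ‖1 - E‖ := by
          have := norm_sub_norm_le 1 E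
          rwa [norm_one] at this
        exact ⟨by nlinarith, by nlinarith⟩
    have hne : (1 - E) ≠ 0 := norm_pos_iff.1 hlow.1
    refine ⟨1 / (1 - E), by field_simp; ring, ?_⟩
    have h1 : 1 - 1 / (1 - E) = -E / (1 - E) := by field_simp; ring
    rw [h1, norm_div, norm_div, norm_neg, norm_one, ← add_div, div_le_iff₀ hlow.1]
    have h2 : 1 + 2 / (U - 1) = (U + 1) / (U - 1) := by field_simp; ring
    rw [h2, div_mul_eq_mul_div, le_div_iff₀ hu]
    exact hlow.2

/-- This is where ρ < 1 enters: with a = 1 / (1 + r^ρ) the product a r is at least r^{1-ρ} / 2,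
whose exponential beats any power of r. The shift and the excess of total variation at a point of
modulus r can then both be bounded by the summable quantity a. -/
lemma exists_exp_bound {ρ : ℝ} (h0 : 0 ≤ ρ) (h1 : ρ < 1) :
    ∃ R : ℝ, ∀ r, R ≤ r → Real.pi < 1 / (1 + r ^ ρ) * r ∧
      2 / (Real.exp (1 / (1 + r ^ ρ) * r - Real.pi) - 1) ≤ 1 / (1 + r ^ ρ) := by
  -- The variable is r^{1-ρ}, and its power ρ / (1 - ρ) is r^ρ.
  have hlo := (isLittleO_rpow_exp_pos_mul_atTop (ρ / (1 - ρ)) (b := 1 / 2) (by norm_num)).comp_tendsto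
    (tendsto_rpow_atTop (y := 1 - ρ) (by linarith))
  have hev := hlo.bound (c := (5 * Real.exp Real.pi)⁻¹) (by positivity)
  obtain ⟨R, hR⟩ := eventually_atTop.1 (hev.and (eventually_ge_atTop (1 : ℝ)))
  refine ⟨R, fun r hr => ?_⟩
  obtain ⟨h2, h3⟩ := hR r hr
  have hr0 : 0 < r := by linarith
  have hp : 1 ≤ r ^ ρ := Real.one_le_rpow h3 h0
  have hpow : (r ^ (1 - ρ)) ^ (ρ / (1 - ρ)) = r ^ ρ := by
    rw [← Real.rpow_mul hr0.le]
    congr 1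
    field_simp [show (1 - ρ) ≠ 0 by linarith]
  simp only [Function.comp_apply] at h2
  rw [hpow, Real.norm_of_nonneg (by positivity), Real.norm_of_nonneg (Real.exp_pos _).le] at h2
  have h4 : 1 / 2 * r ^ (1 - ρ) ≤ 1 / (1 + r ^ ρ) * r := by
    rw [Real.rpow_sub hr0, Real.rpow_one, div_mul_div_comm, one_mul, div_mul_eq_mul_div, one_mul]
    gcongr
    linarith
  -- The final estimate needs 2 (1 + r^ρ) + 1 ≤ exp(a r - π); since r^ρ ≥ 1, the factor 5 is enough.
  have h5 : 5 * Real.exp Real.pi * r ^ ρ ≤ Real.exp (1 / (1 + r ^ ρ) * r) := by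
    have h6 : 5 * Real.exp Real.pi * r ^ ρ ≤ Real.exp (1 / 2 * r ^ (1 - ρ)) := by
      rw [inv_mul_eq_div, le_div_iff₀ (by positivity)] at h2
      linarith
    exact h6.trans (Real.exp_le_exp.2 h4)
  have h7 : 5 * r ^ ρ ≤ Real.exp (1 / (1 + r ^ ρ) * r - Real.pi) := by
    rw [Real.exp_sub, le_div_iff₀ (Real.exp_pos _)]
    linarith
  constructor
  · by_contra h
    have : Real.exp (1 / (1 + r ^ ρ) * r - Real.pi) ≤ 1 := Real.exp_le_one_iff.2 (by linarith)
    linarith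
  · rw [div_le_div_iff₀ (by linarith) (by linarith)]
    linarith

/-- Integration by parts. The operator d/dt + l creates a zero at l without enlarging the support
and without affecting nonvanishing elsewhere. -/
lemma laplace_deriv_add {f : ℝ → ℂ} (hf : ContDiff ℝ ∞ f) (hc : HasCompactSupport f) (l z : ℂ) :
    laplace (fun t => deriv f t + l * f t) z = (l - z) * laplace f z := by
  have hf' : Continuous (deriv f) := hf.continuous_deriv (by simp)
  have hfd : ∀ t, HasDerivAt f (deriv f t) t := fun t =>
    (hf.differentiable (by simp) t).hasDerivAt
  have hed : ∀ t : ℝ, HasDerivAt (fun t : ℝ => Complex.exp (z * t)) (Complex.exp (z * t) * z) t := by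
    intro t
    have h1 : HasDerivAt (fun t : ℝ => z * (t : ℂ)) z t := by
      simpa using (Complex.ofRealCLM.hasDerivAt (x := t)).const_mul z
    exact h1.cexp
  have h1 : ∫ t : ℝ, Complex.exp (z * t) * deriv f t = -∫ t : ℝ, Complex.exp (z * t) * z * f t := by
    refine integral_mul_deriv_eq_deriv_mul_of_integrable (fun t _ => hed t) (fun t _ => hfd t) ?_ ?_ ?_
    · exact integrable_exp_mul hf' hc.deriv z
    · have : (fun t : ℝ => Complex.exp (z * t) * z) * f =
          fun t : ℝ => Complex.exp (z * t) * (z * f t) := by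
        ext t; simp only [Pi.mul_apply]; ring
      rw [this]
      exact integrable_exp_mul (continuous_const.mul hf.continuous) hc.mul_left z
    · exact integrable_exp_mul hf.continuous hc z
  have h2 : ∫ t : ℝ, Complex.exp (z * t) * z * f t = z * laplace f z := by
    rw [laplace, ← integral_const_mul]
    congr 1
    ext t
    ring
  calc laplace (fun t => deriv f t + l * f t) z
      = ∫ t : ℝ, (Complex.exp (z * t) * deriv f t + l * (Complex.exp (z * t) * f t)) := by
        rw [laplace]
        congr 1
        ext t
        ring
    _ = _ := by
        rw [integral_add (integrable_exp_mul hf' hc.deriv z)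
          ((integrable_exp_mul hf.continuous hc z).const_mul _), integral_const_mul, h1, h2, laplace]
        ring

/-- A test function whose Laplace transform vanishes on a finite set, but not at `z₀`. -/
lemma exists_testFunction_finset (S : Finset ℂ) {z₀ : ℂ} (hS : z₀ ∉ S) {α β : ℝ} (hαβ : α < β) :
    ∃ f : ℝ → ℂ, ContDiff ℝ ∞ f ∧ (∀ t, t ∉ Icc α β → f t = 0) ∧
      (∀ z ∈ S, laplace f z = 0) ∧ laplace f z₀ ≠ 0 := by
  induction S using Finset.induction_on with
  | empty =>
    let B : ContDiffBump ((α + β) / 2) :=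
      ⟨(β - α) / 4, (β - α) / 2, by linarith, by linarith⟩
    have hB : ContDiff ℝ ∞ B := B.contDiff
    -- The twist by e^{-z₀ t} turns the transform at z₀ into the integral of a nonnegative bump.
    refine ⟨fun t => Complex.exp (-z₀ * t) * (B t : ℂ), ?_, ?_, by simp, ?_⟩
    · have h1 : ContDiff ℝ ∞ (fun t : ℝ => (t : ℂ)) := Complex.ofRealCLM.contDiff
      exact (contDiff_const.mul h1).cexp.mul (h1.comp hB)
    · intro t ht
      have : B t = 0 := by
        refine B.zero_of_le_dist ?_
        rw [Real.dist_eq]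
        by_contra h
        have := abs_lt.1 (not_le.1 h)
        simp only [B] at this
        exact ht ⟨by linarith [this.1], by linarith [this.2]⟩
      simp [this]
    · have h1 : laplace (fun t => Complex.exp (-z₀ * t) * (B t : ℂ)) z₀ = ∫ t : ℝ, (B t : ℂ) := by
        rw [laplace]
        congr 1
        ext t
        rw [← mul_assoc, ← Complex.exp_add]
        simp
      rw [h1, integral_complex_ofReal]
      exact_mod_cast (B.integral_pos).ne'
  | insert l S hl ih =>
    obtain ⟨f, hf, hfs, hfz, hf0⟩ := ih (fun h => hS (Finset.mem_insert_of_mem h))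
    have hc := hasCompactSupport_of_eq_zero hfs
    refine ⟨fun t => deriv f t + l * f t, ?_, ?_, ?_, ?_⟩
    · exact ((contDiff_infty_iff_deriv.1 hf).2).add (contDiff_const.mul hf)
    · intro t ht
      have h1 : deriv f t = 0 := by
        by_contra h
        exact ht (tsupport_subset_of_eq_zero hfs (support_deriv_subset h))
      simp [h1, hfs t ht]
    · intro z hz
      rw [laplace_deriv_add hf hc]
      rcases Finset.mem_insert.1 hz with rfl | hz
      · simp
      · simp [hfz z hz]
    · rw [laplace_deriv_add hf hc]
      refine mul_ne_zero (sub_ne_zero.2 ?_) hf0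
      rintro rfl
      exact hS (Finset.mem_insert_self _ _)

/-- If the `lam i` are sparse of order less than one, there is a test function with support in
`(0, T)` whose Laplace transform vanishes at all of them except at `z₀`. -/
theorem exists_testFunction {ι : Type*} (lam : ι → ℂ) {ρ : ℝ} (h0 : 0 ≤ ρ) (h1 : ρ < 1)
    (hs : Summable fun i => 1 / (1 + ‖lam i‖ ^ ρ)) (z₀ : ℂ) {T : ℝ} (hT : 0 < T) :
    ∃ h : ℝ → ℂ, ContDiff ℝ ∞ h ∧ (∀ t, t ∉ Icc (T / 4) (3 * T / 4) → h t = 0) ∧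
      (∀ i, lam i ≠ z₀ → laplace h (lam i) = 0) ∧ laplace h z₀ ≠ 0 := by
  classical
  set s : ι → ℝ := fun i => 1 / (1 + ‖lam i‖ ^ ρ) with hs_def
  have hspos : ∀ i, 0 < s i := fun i => by positivity
  obtain ⟨R, hR⟩ := exists_exp_bound h0 h1
  have hfin : {i | ¬ R ≤ ‖lam i‖}.Finite := by
    have h2 : ∀ᶠ i in cofinite, s i < 1 / (1 + (max R 0) ^ ρ) :=
      hs.tendsto_cofinite_zero.eventually_lt_const (by positivity)
    refine (eventually_cofinite.1 h2).subset fun i hi hlt => hi ?_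
    by_contra hlt'
    have h3 : ‖lam i‖ ^ ρ ≤ (max R 0) ^ ρ :=
      Real.rpow_le_rpow (norm_nonneg _) ((not_le.1 hlt').le.trans (le_max_left _ _)) h0
    exact absurd hlt (not_lt.2 (one_div_le_one_div_of_le (by positivity) (by linarith)))
  -- The tail sum of `s` will be less than η. The first bound keeps the support, initially in [T/4,
  -- T/2], inside [T/4, 3T/4]; the second keeps the infinite product at z₀ close to 1.
  set η : ℝ := min (T / 4) (1 / (8 * (1 + ‖z₀‖))) with hη
  have hη0 : 0 < η := lt_min (by linarith) (by positivity)
  obtain ⟨S₁, hS₁⟩ := (eventually_atTop.1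
    ((tendsto_tsum_compl_atTop_zero s).eventually_lt_const hη0))
  -- Exceptional indices, treated by differential operators: those outside the small tail, and those
  -- of modulus too small for a two-point factor.
  set S := S₁ ∪ hfin.toFinset
  have hS := hS₁ S Finset.subset_union_left
  have hSR : ∀ i : {i // i ∉ S}, R ≤ ‖lam i‖ := by
    intro i
    by_contra h
    exact i.2 (Finset.mem_union_right _ (hfin.mem_toFinset.2 h))
  have hs' : Summable fun i : {i // i ∉ S} => s i := hs.subtype _
  have : Countable ι := by
    have := hs.countable_support
    have h2 : Function.support s = univ := eq_univ_of_forall fun i => (hspos i).ne'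
    rwa [h2, countable_univ_iff] at this
  have : Encodable {i // i ∉ S} := Encodable.ofCountable _
  have hker : ∀ i : {i // i ∉ S}, ∃ b : ℝ, 0 ≤ b ∧ b ≤ s i ∧ ∃ w : ℂ,
      (1 - w) + w * Complex.exp (lam i * b) = 0 ∧ ‖1 - w‖ + ‖w‖ ≤ 1 + s i := by
    intro i
    obtain ⟨h2, h3⟩ := hR _ (hSR i)
    obtain ⟨b, hb0, hb, w, hw, hw'⟩ := exists_twoPoint_vanishing (lam i) (hspos i) h2
    exact ⟨b, hb0, hb, w, hw, hw'.trans (by linarith)⟩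
  choose b hb0 hbs w hw hws using hker
  have hinj : Function.Injective (Encodable.encode : {i // i ∉ S} → ℕ) := Encodable.encode_injective
  -- Unused integers get shift 0 and weight 0, that is, convolution with δ_0.
  set b' : ℕ → ℝ := Function.extend Encodable.encode b 0 with hb'
  set w' : ℕ → ℂ := Function.extend Encodable.encode w 0 with hw'
  set s' : ℕ → ℝ := Function.extend Encodable.encode (fun i : {i // i ∉ S} => s i) 0 with hs'_def
  have hb'e : ∀ i : {i // i ∉ S}, b' (Encodable.encode i) = b i := fun i => hinj.extend_apply _ _ _
  have hw'e : ∀ i : {i // i ∉ S}, w' (Encodable.encode i) = w i := fun i => hinj.extend_apply _ _ _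
  have hs'e : ∀ i : {i // i ∉ S}, s' (Encodable.encode i) = s i := fun i =>
    hinj.extend_apply (fun i : {i // i ∉ S} => s i) _ _
  have hcases : ∀ n, (∃ i : {i // i ∉ S}, Encodable.encode i = n) ∨
      (b' n = 0 ∧ w' n = 0 ∧ s' n = 0) := by
    intro n
    by_cases h : ∃ i : {i // i ∉ S}, Encodable.encode i = n
    · exact Or.inl h
    · exact Or.inr ⟨Function.extend_apply' _ _ _ h, Function.extend_apply' _ _ _ h,
        Function.extend_apply' _ _ _ h⟩
  have hsupp : Function.support s' ⊆ range (Encodable.encode : {i // i ∉ S} → ℕ) := by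
    intro n hn
    rcases hcases n with h | h
    · exact h
    · exact absurd h.2.2 hn
  have hs's : Summable s' := by
    refine (hinj.summable_iff fun n hn => by_contra fun h => hn (hsupp h)).1 ?_
    exact hs'.congr fun i => (hs'e i).symm
  have hs't : ∑' n, s' n < η := by
    rw [← hinj.tsum_eq hsupp]
    simpa only [hs'e] using hS
  have hs'0 : ∀ n, 0 ≤ s' n := by
    intro n
    rcases hcases n with ⟨i, rfl⟩ | h
    · rw [hs'e]; exact (hspos _).le
    · rw [h.2.2]
  have hb'0 : ∀ n, 0 ≤ b' n := by
    intro n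
    rcases hcases n with ⟨i, rfl⟩ | h
    · rw [hb'e]; exact hb0 i
    · rw [h.1]
  have hb's : ∀ n, b' n ≤ s' n := by
    intro n
    rcases hcases n with ⟨i, rfl⟩ | h
    · rw [hb'e, hs'e]; exact hbs i
    · rw [h.1, h.2.2]
  have hw's : ∀ n, ‖1 - w' n‖ + ‖w' n‖ ≤ 1 + s' n := by
    intro n
    rcases hcases n with ⟨i, rfl⟩ | h
    · rw [hw'e, hs'e]; exact hws i
    · rw [h.2.1, h.2.2]; simp
  have hb'sum : Summable b' := Summable.of_nonneg_of_le hb'0 hb's hs's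
  have hs'1 : ∀ n, s' n < η := fun n => (hs's.le_tsum n fun i _ => hs'0 i).trans_lt hs't
  have hη1 : η ≤ 1 / (8 * (1 + ‖z₀‖)) := min_le_right _ _
  have hη2 : (8 * (1 + ‖z₀‖)) * η ≤ 1 := by
    rwa [le_div_iff₀ (by positivity), mul_comm] at hη1
  have hw'2 : ∀ n, ‖w' n‖ ≤ 2 := by
    intro n
    have h2 : η ≤ 1 := by nlinarith [norm_nonneg z₀]
    linarith [hw's n, norm_nonneg (1 - w' n), hs'1 n]
  obtain ⟨f, hf, hfs, hfz, hf0⟩ := exists_testFunction_finset ((S.image lam).erase z₀)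
    (Finset.notMem_erase _ _) (show T / 4 < T / 2 by linarith)
  obtain ⟨h, hh, hhs, hlim⟩ := exists_limit_iterTwoPoint hf hfs hb'0 hb'sum hs'0 hs's hw's hw'2
  refine ⟨h, hh, fun t ht => hhs t fun h2 => ht ⟨h2.1, h2.2.trans ?_⟩, fun i hi => ?_, ?_⟩
  · have h3 : ∑' n, b' n ≤ ∑' n, s' n := hb'sum.tsum_le_tsum hb's hs's
    have h4 : η ≤ T / 4 := min_le_left _ _
    linarith
  · by_cases hiS : i ∈ S
    · have h2 : laplace f (lam i) = 0 :=
        hfz _ (Finset.mem_erase.2 ⟨hi, Finset.mem_image_of_mem _ hiS⟩)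
      have h3 := hlim (lam i)
      simp only [h2, mul_zero] at h3
      exact tendsto_nhds_unique h3 tendsto_const_nhds
    · refine tendsto_nhds_unique (hlim (lam i)) (tendsto_const_nhds.congr' ?_)
      filter_upwards [eventually_gt_atTop (Encodable.encode (⟨i, hiS⟩ : {i // i ∉ S}))] with n hn
      rw [Finset.prod_eq_zero (Finset.mem_range.2 hn), zero_mul]
      rw [hb'e, hw'e]
      exact hw ⟨i, hiS⟩
  · intro hzero
    -- The factors at z₀ are 1 + `x n` with ∑ ‖x n‖ ≤ 1/2, so the partial products stay within
    -- e^{1/2} - 1 < 1 of 1. In particular no index with `lam i = z₀` lies in the tail, as its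
    -- factor would be 0.
    set x : ℕ → ℂ := fun n => w' n * (Complex.exp (z₀ * b' n) - 1) with hx
    have hxb : ∀ n, ‖x n‖ ≤ 4 * ‖z₀‖ * s' n := by
      intro n
      have h2 : ‖z₀ * b' n‖ = ‖z₀‖ * b' n := by
        rw [norm_mul, Complex.norm_real, Real.norm_of_nonneg (hb'0 n)]
      have h3 : ‖z₀‖ * b' n ≤ ‖z₀‖ * s' n := mul_le_mul_of_nonneg_left (hb's n) (norm_nonneg _)
      have h4 : ‖z₀ * b' n‖ ≤ 1 := by
        rw [h2]
        nlinarith [hs'1 n, norm_nonneg z₀]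
      have h5 := Complex.norm_exp_sub_one_le h4
      rw [h2] at h5
      calc ‖x n‖ = ‖w' n‖ * ‖Complex.exp (z₀ * b' n) - 1‖ := norm_mul _ _
        _ ≤ 2 * (2 * (‖z₀‖ * b' n)) := by
            gcongr
            exact hw'2 n
        _ ≤ _ := by linarith
    have hprod : ∀ n, ‖∏ k ∈ Finset.range n, ((1 - w' k) + w' k * Complex.exp (z₀ * b' k)) - 1‖ ≤
        Real.exp (1 / 2) - 1 := by
      intro n
      have h2 : ∀ k, (1 - w' k) + w' k * Complex.exp (z₀ * b' k) = 1 + x k := fun k => by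
        simp only [hx]; ring
      simp_rw [h2]
      refine (Finset.norm_prod_one_add_sub_one_le _ x).trans ?_
      have h3 : ∑ i ∈ Finset.range n, ‖x i‖ ≤ 4 * ‖z₀‖ * ∑' i, s' i := by
        refine (Finset.sum_le_sum fun i _ => hxb i).trans ?_
        rw [← Finset.mul_sum]
        gcongr
        exact hs's.sum_le_tsum _ fun i _ => hs'0 i
      have h4 : 4 * ‖z₀‖ * ∑' i, s' i ≤ 1 / 2 := by
        have : 4 * ‖z₀‖ * ∑' i, s' i ≤ 4 * ‖z₀‖ * η := by gcongr
        linarith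
      linarith [Real.exp_le_exp.2 (h3.trans h4)]
    have hlim' : Tendsto (fun n => ‖(∏ k ∈ Finset.range n,
        ((1 - w' k) + w' k * Complex.exp (z₀ * b' k))) * laplace f z₀ - laplace f z₀‖) atTop
        (𝓝 ‖laplace h z₀ - laplace f z₀‖) := ((hlim z₀).sub_const _).norm
    have hle : ‖laplace h z₀ - laplace f z₀‖ ≤ (Real.exp (1 / 2) - 1) * ‖laplace f z₀‖ := by
      refine le_of_tendsto' hlim' fun n => ?_
      rw [← sub_one_mul, norm_mul]
      exact mul_le_mul_of_nonneg_right (hprod n) (norm_nonneg _)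
    rw [hzero, zero_sub, norm_neg] at hle
    have hpos : 0 < ‖laplace f z₀‖ := norm_pos_iff.2 hf0
    have h2 : Real.exp (1 / 2) < 2 := by
      have h3 : Real.exp (1 / 2) * Real.exp (1 / 2) = Real.exp 1 := by
        rw [← Real.exp_add]; norm_num
      nlinarith [Real.exp_one_lt_d9, Real.exp_pos (1 / 2)]
    nlinarith

end TestFunctions

/-! ### Consequences of the trace formula -/

section TraceFormula

variable {d : ℕ} {M : Type u} [TopologicalSpace M] [ChartedSpace (EuclideanSpace ℝ (Fin (d + 1))) M]
  [IsManifold (𝓡 (d + 1)) ∞ M]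

/-- Apart from the weight of the trace formula, the term depends on the orbit only through its
length; this is what allows grouping by length. -/
lemma detTerm_eq (F : AnosovFlow d M) (g : M → ℂ) (s : ℂ) (γ : F.PeriodicOrbit) :
    F.detTerm g s γ = F.traceWeight g γ * (Complex.exp (-s * γ.length) / γ.length) := by
  simp only [AnosovFlow.detTerm, AnosovFlow.traceWeight]
  push_cast
  ring

variable [MeasurableSpace M]

/-- The trace formula is incompatible with a sparse nonempty set of resonances, as its geometric
side vanishes near zero. -/
theorem isEmpty_resonance [BorelSpace M] {F : AnosovFlow d M} {g : M → ℂ} (htrace : TraceFormula F g) {ρ : ℝ}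
    (h0 : 0 ≤ ρ) (h1 : ρ < 1) (hρ : ResonanceSumFinite F g ρ) {T : ℝ} (hT : 0 < T)
    (hlen : ∀ γ : F.PeriodicOrbit, T ≤ γ.length) : IsEmpty (Resonance F g) := by
  classical
  refine ⟨fun p₀ => ?_⟩
  have hs : Summable fun p : Resonance F g => 1 / (1 + ‖p.value‖ ^ ρ) := by
    refine Summable.of_nonneg_of_le (fun p => by positivity) (fun p => ?_) hρ
    have h2 : (1 : ℝ) ≤ p.mult := by exact_mod_cast (p.2.1 : 0 < p.mult)
    exact le_mul_of_one_le_left (by positivity) h2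
  obtain ⟨h, hh, hhs, hz, hz0⟩ := exists_testFunction (fun p : Resonance F g => p.value) h0 h1 hs
    p₀.value hT
  obtain ⟨S, hS1, hS2⟩ := htrace h hh (hasCompactSupport_of_eq_zero hhs)
    ((tsupport_subset_of_eq_zero hhs).trans fun t ht => lt_of_lt_of_le (by linarith) ht.1)
  have hS0 : S = 0 := by
    refine hS2.unique ?_
    have : ∀ γ : F.PeriodicOrbit, F.traceWeight g γ * h γ.length = 0 := fun γ => by
      rw [hhs _ fun h2 => by linarith [h2.2, hlen γ], mul_zero]
    simpa only [this] using hasSum_zero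
  rw [hS0] at hS1
  -- Dividing by the transform at the chosen point leaves a sum of multiplicities. The index type
  -- consists of pairs, and several pairs with the same value are not excluded here; nonnegativity
  -- makes each multiplicity vanish.
  have hS3 : HasSum (fun p : Resonance F g =>
      ((if p.value = p₀.value then (p.mult : ℝ) else 0 : ℝ) : ℂ)) ((0 : ℝ) : ℂ) := by
    have h2 := hS1.mul_right (laplace h p₀.value)⁻¹
    rw [zero_mul] at h2
    rw [Complex.ofReal_zero]
    refine (funext fun p => ?_ : (fun p : Resonance F g =>
      ((if p.value = p₀.value then (p.mult : ℝ) else 0 : ℝ) : ℂ)) = _) ▸ h2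
    by_cases hp : p.value = p₀.value
    · rw [if_pos hp, hp]
      change _ = (p.mult : ℂ) * laplace h p₀.value * _
      rw [mul_assoc, mul_inv_cancel₀ hz0]
      simp
    · rw [if_neg hp]
      change _ = (p.mult : ℂ) * laplace h p.value * _
      rw [hz p hp]
      simp
  have hS4 := Complex.hasSum_ofReal.1 hS3
  have h2 := (hasSum_zero_iff_of_nonneg (fun p => by
    change (0 : ℝ) ≤ if _ then _ else _
    split_ifs <;> positivity)).1 hS4
  have h3 := congrFun h2 p₀
  simp only [if_true, Pi.zero_apply, Nat.cast_eq_zero] at h3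
  exact (p₀.2.1 : 0 < p₀.mult).ne' h3

/-- Without resonances, the orbits of any given length have total weight zero. -/
lemma tsum_traceWeight_eq_zero {F : AnosovFlow d M} {g : M → ℂ} (htrace : TraceFormula F g)
    (hE : IsEmpty (Resonance F g)) (T : ℝ) :
    ∑' γ : (fun γ : F.PeriodicOrbit => γ.length) ⁻¹' {T}, F.traceWeight g γ = 0 := by
  classical
  by_cases hT : 0 < T
  swap
  · have : IsEmpty ((fun γ : F.PeriodicOrbit => γ.length) ⁻¹' {T}) :=
      ⟨fun γ => hT (by have h2 : γ.1.length = T := γ.2; rw [← h2]; exact γ.1.length_pos)⟩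
    exact tsum_empty
  have hzero : ∀ h : ℝ → ℂ, ContDiff ℝ ∞ h → HasCompactSupport h → tsupport h ⊆ Ioi 0 →
      HasSum (fun γ : F.PeriodicOrbit => F.traceWeight g γ * h γ.length) 0 := by
    intro h hh hc hs
    obtain ⟨S, hS1, hS2⟩ := htrace h hh hc hs
    rwa [hS1.unique hasSum_empty] at hS2
  have hbump : ∀ B : ContDiffBump T, B.rOut < T →
      HasSum (fun γ : F.PeriodicOrbit => F.traceWeight g γ * (B γ.length : ℂ)) 0 := by
    intro B hB
    have hc : HasCompactSupport fun t => (B t : ℂ) := B.hasCompactSupport.comp_left (g := Complex.ofReal) rfl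
    refine hzero (fun t => (B t : ℂ)) ?_ hc ?_
    · exact Complex.ofRealCLM.contDiff.comp B.contDiff
    · refine (tsupport_comp_subset (g := Complex.ofReal) rfl B).trans fun t ht => ?_
      rw [B.tsupport_eq, Metric.mem_closedBall, Real.dist_eq] at ht
      have := (abs_le.1 ht).1
      exact mem_Ioi.2 (by linarith)
  let B : ℕ → ContDiffBump T := fun n =>
    ⟨T / 8 / (n + 1), T / 4 / (n + 1), by positivity, by gcongr; linarith⟩
  let B₀ : ContDiffBump T := ⟨T / 4, T / 2, by linarith, by linarith⟩
  have hn1 : ∀ n : ℕ, T / 4 / (n + 1) ≤ T / 4 := fun n =>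
    div_le_self (by linarith) (by linarith [(Nat.cast_nonneg n : (0 : ℝ) ≤ n)])
  have hB : ∀ n, HasSum (fun γ : F.PeriodicOrbit => F.traceWeight g γ * (B n γ.length : ℂ)) 0 :=
    fun n => hbump (B n) (by
      change T / 4 / (n + 1) < T
      linarith [hn1 n])
  have hB₀ := hbump B₀ (by change T / 2 < T; linarith)
  -- The bumps `B n` shrink to the point T and equal 1 there, so they converge to its indicator. The
  -- fixed bump `B₀` dominates them all, and its own series converges absolutely by the trace
  -- formula.
  have hlim := tendsto_tsum_of_dominated_convergence (𝓕 := atTop)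
    (f := fun n (γ : F.PeriodicOrbit) => F.traceWeight g γ * (B n γ.length : ℂ))
    (g := ((fun γ : F.PeriodicOrbit => γ.length) ⁻¹' {T}).indicator (F.traceWeight g))
    hB₀.summable.norm (fun γ => ?_) (.of_forall fun n γ => ?_)
  · simp only [(hB _).tsum_eq] at hlim
    rw [tsum_subtype]
    exact tendsto_nhds_unique hlim tendsto_const_nhds
  · by_cases hγ : γ.length = T
    · have h2 : ∀ n, (B n γ.length : ℂ) = 1 := fun n => by
        rw [(B n).one_of_mem_closedBall (by rw [hγ]; exact Metric.mem_closedBall_self (B n).rIn_pos.le)]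
        simp
      simp only [h2, mul_one]
      rw [indicator_of_mem (by exact hγ)]
      exact tendsto_const_nhds
    · rw [indicator_of_notMem (by exact hγ)]
      refine tendsto_const_nhds.congr' ?_
      have h2 : 0 < dist γ.length T := dist_pos.2 hγ
      have h3 : Tendsto (fun n : ℕ => T / 4 / ((n : ℝ) + 1)) atTop (𝓝 0) :=
        tendsto_const_nhds.div_atTop (tendsto_natCast_atTop_atTop.atTop_add tendsto_const_nhds)
      filter_upwards [h3.eventually_le_const h2] with n hn
      rw [(B n).zero_of_le_dist hn]
      simp
  · rw [norm_mul, norm_mul]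
    refine mul_le_mul_of_nonneg_left ?_ (norm_nonneg _)
    rw [Complex.norm_real, Complex.norm_real, Real.norm_of_nonneg (B n).nonneg,
      Real.norm_of_nonneg B₀.nonneg]
    by_cases h2 : dist γ.length T ≤ T / 4
    · rw [B₀.one_of_mem_closedBall h2]
      exact (B n).le_one
    · rw [(B n).zero_of_le_dist ((hn1 n).trans (not_le.1 h2).le)]
      exact B₀.nonneg

lemma dynamicalDeterminant_eq_one {F : AnosovFlow d M} {g : M → ℂ} (htrace : TraceFormula F g)
    (hE : IsEmpty (Resonance F g)) {s : ℂ} (hs : Summable (F.detTerm g s)) :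
    F.dynamicalDeterminant g s = 1 := by
  have h1 := hs.hasSum.tsum_fiberwise (fun γ : F.PeriodicOrbit => γ.length)
  have h2 : ∀ T : ℝ, ∑' γ : (fun γ : F.PeriodicOrbit => γ.length) ⁻¹' {T}, F.detTerm g s γ = 0 := by
    intro T
    have : ∀ γ : (fun γ : F.PeriodicOrbit => γ.length) ⁻¹' {T}, F.detTerm g s γ =
        F.traceWeight g γ * (Complex.exp (-s * T) / T) := fun γ => by
      have h3 : γ.1.length = T := γ.2
      rw [detTerm_eq, h3]
    simp_rw [this]
    rw [tsum_mul_right, tsum_traceWeight_eq_zero htrace hE, zero_mul]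
  simp only [h2] at h1
  rw [AnosovFlow.dynamicalDeterminant, h1.unique hasSum_zero]
  simp

end TraceFormula

/-! ### Comparison of norms on the tangent bundle -/

section TangentBundle

variable {d : ℕ} {M : Type u} [TopologicalSpace M] [ChartedSpace (EuclideanSpace ℝ (Fin (d + 1))) M]
  [IsManifold (𝓡 (d + 1)) ∞ M]

/-- On a compact manifold, a continuous function on the tangent bundle which is homogeneous on the
fibres is bounded by any other one which is positive outside the zero section. -/
lemma exists_le_mul_of_homogeneous [CompactSpace M]
    {N₁ N₂ : ∀ x : M, TangentSpace (𝓡 (d + 1)) x → ℝ}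
    (h₁ : Continuous fun p : TangentBundle (𝓡 (d + 1)) M => N₁ p.1 p.2)
    (h₂ : Continuous fun p : TangentBundle (𝓡 (d + 1)) M => N₂ p.1 p.2)
    (hom₁ : ∀ x (c : ℝ) v, 0 ≤ c → N₁ x (c • v) = c * N₁ x v)
    (hom₂ : ∀ x (c : ℝ) v, 0 ≤ c → N₂ x (c • v) = c * N₂ x v)
    (hpos : ∀ x v, v ≠ 0 → 0 < N₂ x v) : ∃ C > 0, ∀ x v, N₁ x v ≤ C * N₂ x v := by
  by_contra! hcon
  choose x v hxv using fun n : ℕ => hcon (n + 1) (by positivity)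
  have hv : ∀ n, v n ≠ 0 := by
    intro n h0
    have e1 : N₁ (x n) (v n) = 0 := by
      have := hom₁ (x n) 0 (v n) le_rfl
      rw [zero_smul, zero_mul] at this
      rw [h0]; exact this
    have e2 : N₂ (x n) (v n) = 0 := by
      have := hom₂ (x n) 0 (v n) le_rfl
      rw [zero_smul, zero_mul] at this
      rw [h0]; exact this
    have := hxv n
    rw [e1, e2] at this
    simp at this
  -- Limits along an ultrafilter replace subsequences. The counterexamples are rescaled to have unit
  -- fibre coordinate in the trivialization at the limit point; their limit is a nonzero vector,
  -- where N₂ is positive and N₁ finite, against N₁ > (n + 1) N₂.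
  obtain ⟨p, -, hp⟩ := isCompact_univ.ultrafilter_le_nhds ((hyperfilter ℕ).map x) (by simp)
  have hx : Tendsto x (hyperfilter ℕ) (𝓝 p) := hp
  set t := trivializationAt (EuclideanSpace ℝ (Fin (d + 1))) (TangentSpace (𝓡 (d + 1))) p with ht
  set ξ : ℕ → EuclideanSpace ℝ (Fin (d + 1)) := fun n => (t ⟨x n, v n⟩).2 with hξ
  have hbase : ∀ᶠ n in (hyperfilter ℕ : Filter ℕ), x n ∈ t.baseSet :=
    hx.eventually (t.open_baseSet.mem_nhds (FiberBundle.mem_baseSet_trivializationAt' p))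
  have hsph : ∀ᶠ n in (hyperfilter ℕ : Filter ℕ),
      ‖ξ n‖⁻¹ • ξ n ∈ Metric.closedBall (0 : EuclideanSpace ℝ (Fin (d + 1))) 1 := by
    refine .of_forall fun n => ?_
    rw [mem_closedBall_zero_iff, norm_smul, norm_inv, norm_norm]
    exact inv_mul_le_one
  obtain ⟨u, -, hu⟩ := (isCompact_closedBall (0 : EuclideanSpace ℝ (Fin (d + 1))) 1).ultrafilter_le_nhds
    ((hyperfilter ℕ).map fun n => ‖ξ n‖⁻¹ • ξ n) (le_principal_iff.2 hsph)
  have hu : Tendsto (fun n => ‖ξ n‖⁻¹ • ξ n) (hyperfilter ℕ) (𝓝 u) := hu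
  have hsymm : ∀ n, x n ∈ t.baseSet → t.symm (x n) (ξ n) = v n := fun n hn =>
    t.symm_apply_apply_mk hn (v n)
  have hξ0 : ∀ n, x n ∈ t.baseSet → 0 < ‖ξ n‖ := by
    intro n hn
    rw [norm_pos_iff]
    intro h0
    have h1 := hsymm n hn
    rw [h0] at h1
    have h2 : t.symm (x n) 0 = 0 := by
      rw [← t.symmL_apply (R := ℝ) hn, map_zero]
    exact hv n (h1.symm.trans h2)
  have hu1 : ‖u‖ = 1 := by
    refine tendsto_nhds_unique hu.norm (tendsto_const_nhds.congr' ?_)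
    filter_upwards [hbase] with n hn
    rw [norm_smul, norm_inv, norm_norm, inv_mul_cancel₀ (hξ0 n hn).ne']
  have hpt : p ∈ t.baseSet := FiberBundle.mem_baseSet_trivializationAt' p
  have hlim : Tendsto (fun n => t.toOpenPartialHomeomorph.symm (x n, ‖ξ n‖⁻¹ • ξ n)) (hyperfilter ℕ)
      (𝓝 (t.toOpenPartialHomeomorph.symm (p, u))) := by
    refine ((t.toOpenPartialHomeomorph.continuousAt_symm ?_).tendsto.comp (hx.prodMk_nhds hu))
    rw [t.mem_target]
    exact hpt
  have heq : ∀ n, x n ∈ t.baseSet → t.toOpenPartialHomeomorph.symm (x n, ‖ξ n‖⁻¹ • ξ n) =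
      (⟨x n, ‖ξ n‖⁻¹ • v n⟩ : TangentBundle (𝓡 (d + 1)) M) := by
    intro n hn
    rw [← t.mk_symm hn]
    congr 1
    have h2 : t.symm (x n) (‖ξ n‖⁻¹ • ξ n) = ‖ξ n‖⁻¹ • t.symm (x n) (ξ n) := by
      rw [← t.symmL_apply (R := ℝ) hn, ← t.symmL_apply (R := ℝ) hn, map_smul]
    rw [h2, hsymm n hn]
  have hval : ∀ {N : ∀ x : M, TangentSpace (𝓡 (d + 1)) x → ℝ},
      (Continuous fun p : TangentBundle (𝓡 (d + 1)) M => N p.1 p.2) →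
      (∀ x (c : ℝ) v, 0 ≤ c → N x (c • v) = c * N x v) →
      Tendsto (fun n => ‖ξ n‖⁻¹ * N (x n) (v n)) (hyperfilter ℕ) (𝓝 (N p (t.symm p u))) := by
    intro N hN hom
    have h1 := (hN.tendsto _).comp hlim
    rw [← t.mk_symm hpt] at h1
    refine h1.congr' ?_
    filter_upwards [hbase] with n hn
    simp only [Function.comp_apply]
    rw [heq n hn]
    exact hom _ _ _ (by positivity)
  have hw0 : t.symm p u ≠ 0 := by
    intro h0
    have h1 : (t ⟨p, t.symm p u⟩).2 = u := by rw [t.apply_mk_symm hpt]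
    rw [h0] at h1
    have h2 : (t ⟨p, 0⟩).2 = 0 := by
      have := (t.continuousLinearMapAt ℝ p).map_zero
      rwa [t.continuousLinearMapAt_apply (R := ℝ), t.linearMapAt_apply, if_pos hpt] at this
    rw [h2] at h1
    rw [← h1, norm_zero] at hu1
    exact zero_ne_one hu1
  have hA := hval h₁ hom₁
  have hB := hval h₂ hom₂
  set c := N₂ p (t.symm p u)
  have hc : 0 < c := hpos _ _ hw0
  have hn : Tendsto (fun n : ℕ => (n : ℝ)) (hyperfilter ℕ) atTop :=
    tendsto_natCast_atTop_atTop.mono_left Nat.hyperfilter_le_atTop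
  obtain ⟨n, hn1, hn2, hn3, hn4⟩ := (hbase.and ((hA.eventually_lt_const (lt_add_one _)).and
    ((hB.eventually_const_lt (half_lt_self hc)).and
      (hn.eventually_ge_atTop ((N₁ p (t.symm p u) + 1) / (c / 2)))))).exists
  have h5 : ((n : ℝ) + 1) * (‖ξ n‖⁻¹ * N₂ (x n) (v n)) < ‖ξ n‖⁻¹ * N₁ (x n) (v n) := by
    have := mul_lt_mul_of_pos_left (hxv n) (inv_pos.2 (hξ0 n hn1))
    linarith
  rw [div_le_iff₀ (by positivity)] at hn4
  have hn0 : (0 : ℝ) ≤ n := Nat.cast_nonneg n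
  nlinarith

open scoped Bundle in
/-- The Riemannian norm is continuous on the tangent bundle. -/
lemma continuous_riemannianNorm
    (ρ : Bundle.ContMDiffRiemannianMetric (𝓡 (d + 1)) ∞ (EuclideanSpace ℝ (Fin (d + 1)))
      (fun x : M => TangentSpace (𝓡 (d + 1)) x)) :
    Continuous fun p : TangentBundle (𝓡 (d + 1)) M => √(ρ.inner p.1 p.2 p.2) := by
  let : Bundle.RiemannianBundle (fun x : M => TangentSpace (𝓡 (d + 1)) x) :=
    ⟨ρ.toContinuousRiemannianMetric.toRiemannianMetric⟩
  refine Real.continuous_sqrt.comp ?_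
  exact Continuous.inner_bundle (F := EuclideanSpace ℝ (Fin (d + 1)))
    (E := fun x : M => TangentSpace (𝓡 (d + 1)) x)
    (b := fun p : TangentBundle (𝓡 (d + 1)) M => p.1) (v := fun p => p.2) (w := fun p => p.2)
    continuous_id continuous_id

end TangentBundle

/-! ### Derivatives along the flow and the shortest period -/

namespace AnosovFlow

variable {d : ℕ} {M : Type u} [TopologicalSpace M] [ChartedSpace (EuclideanSpace ℝ (Fin (d + 1))) M]
  [IsManifold (𝓡 (d + 1)) ∞ M] (F : AnosovFlow d M)

lemma contMDiff_flow (t : ℝ) : ContMDiff (𝓡 (d + 1)) (𝓡 (d + 1)) ∞ (F.flow t) :=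
  F.smooth_flow.comp (contMDiff_const.prodMk contMDiff_id)

lemma mdifferentiable_flow (t : ℝ) : MDifferentiable (𝓡 (d + 1)) (𝓡 (d + 1)) (F.flow t) :=
  (F.contMDiff_flow t).mdifferentiable (by simp)

lemma flow_add_eq_comp (s t : ℝ) : F.flow (s + t) = F.flow s ∘ F.flow t :=
  funext fun x => F.flow.map_add s t x

lemma tangentMap_flow_add (s t : ℝ) (q : TangentBundle (𝓡 (d + 1)) M) :
    tangentMap (𝓡 (d + 1)) (𝓡 (d + 1)) (F.flow (s + t)) q =
      tangentMap (𝓡 (d + 1)) (𝓡 (d + 1)) (F.flow s)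
        (tangentMap (𝓡 (d + 1)) (𝓡 (d + 1)) (F.flow t) q) := by
  rw [F.flow_add_eq_comp, tangentMap_comp (I' := 𝓡 (d + 1)) (F.mdifferentiable_flow s)
    (F.mdifferentiable_flow t)]
  rfl

lemma tangentMap_flow_zero (q : TangentBundle (𝓡 (d + 1)) M) :
    tangentMap (𝓡 (d + 1)) (𝓡 (d + 1)) (F.flow 0) q = q := by
  rw [F.flow.map_zero, tangentMap_id]
  rfl

section Observable

variable {E' : Type*} [NormedAddCommGroup E'] [NormedSpace ℝ E'] {e : M → E'}

/-- The derivative of `e ∘ φ^t`. -/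
noncomputable def pushDeriv (e : M → E') (t : ℝ) (x : M) :
    TangentSpace (𝓡 (d + 1)) x →L[ℝ] E' :=
  mfderiv (𝓡 (d + 1)) 𝓘(ℝ, E') (e ∘ F.flow t) x

/-- The derivative of `e` along the flow at `φ^t x`. -/
noncomputable def pushField (e : M → E') (t : ℝ) (x : M) :
    E' :=
  mfderiv (𝓡 (d + 1)) 𝓘(ℝ, E') e (F.flow t x) (F.V (F.flow t x))

lemma pushDeriv_eq (he : ContMDiff (𝓡 (d + 1)) 𝓘(ℝ, E') ∞ e) (t : ℝ) (x : M)
    (v : TangentSpace (𝓡 (d + 1)) x) :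
    F.pushDeriv e t x v = mfderiv (𝓡 (d + 1)) 𝓘(ℝ, E') e (F.flow t x)
      (mfderiv (𝓡 (d + 1)) (𝓡 (d + 1)) (F.flow t) x v) := by
  rw [pushDeriv, mfderiv_comp (I' := 𝓡 (d + 1)) x (he.mdifferentiable (by simp) _)
    (F.mdifferentiable_flow t x)]
  rfl

lemma pushDeriv_zero (x : M) : F.pushDeriv e 0 x = mfderiv (𝓡 (d + 1)) 𝓘(ℝ, E') e x := by
  rw [pushDeriv, F.flow.map_zero, Function.comp_id]

lemma pushDeriv_add (he : ContMDiff (𝓡 (d + 1)) 𝓘(ℝ, E') ∞ e) (s t : ℝ) (x : M)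
    (v : TangentSpace (𝓡 (d + 1)) x) :
    F.pushDeriv e (s + t) x v = F.pushDeriv e s (F.flow t x)
      (mfderiv (𝓡 (d + 1)) (𝓡 (d + 1)) (F.flow t) x v) := by
  rw [pushDeriv, pushDeriv, F.flow_add_eq_comp, ← Function.comp_assoc,
    mfderiv_comp (I' := 𝓡 (d + 1)) x ((he.comp (F.contMDiff_flow s)).mdifferentiable (by simp) _)
    (F.mdifferentiable_flow t x)]
  rfl

lemma hasDerivAt_comp_flow {f : M → E'}
    (hf : ContMDiff (𝓡 (d + 1)) 𝓘(ℝ, E') ∞ f) (t : ℝ) (x : M) :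
    HasDerivAt (fun s => f (F.flow s x)) (F.pushField f t x) t := by
  have h1 := ((hf.mdifferentiable (by simp) (F.flow t x)).hasMFDerivAt).comp t (F.integralCurve x t)
  have h2 : HasFDerivAt (fun s => f (F.flow s x))
      ((1 : ℝ →L[ℝ] ℝ).smulRight (F.pushField f t x)) t := by
    refine HasFDerivAt.congr_fderiv (hasMFDerivAt_iff_hasFDerivAt.1 h1) ?_
    refine ContinuousLinearMap.ext_ring ?_
    change mfderiv (𝓡 (d + 1)) 𝓘(ℝ, E') f (F.flow t x) ((1 : ℝ) • F.V (F.flow t x)) =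
      (1 : ℝ) • mfderiv (𝓡 (d + 1)) 𝓘(ℝ, E') f (F.flow t x) (F.V (F.flow t x))
    rw [one_smul, one_smul]
  simpa using h2.hasDerivAt

lemma pushField_add (s t : ℝ) (x : M) :
    F.pushField e s (F.flow t x) = F.pushField e (s + t) x := by
  rw [pushField, pushField, F.flow.map_add]

/-- The flow preserves its generating field: both sides are the derivative at s = 0 of e(φ^{t+s} x).
-/
lemma pushDeriv_V (he : ContMDiff (𝓡 (d + 1)) 𝓘(ℝ, E') ∞ e) (t : ℝ) (x : M) :
    F.pushDeriv e t x (F.V x) = F.pushField e t x := by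
  have h1 := F.hasDerivAt_comp_flow (he.comp (F.contMDiff_flow t)) 0 x
  have h2 : HasDerivAt (fun s => e (F.flow (t + s) x)) (F.pushField e t x) 0 := by
    have := F.hasDerivAt_comp_flow he (t + 0) x
    rw [add_zero] at this
    refine HasDerivAt.comp_const_add t 0 (by rwa [add_zero])
  have h3 : (fun s => (e ∘ F.flow t) (F.flow s x)) = fun s => e (F.flow (t + s) x) := by
    ext1 s
    simp [F.flow.map_add]
  rw [h3] at h1
  rw [← h1.unique h2, pushDeriv, pushField, F.flow.map_zero]
  rfl

lemma pushField_ne_zero (hinj : ∀ x, Function.Injective (mfderiv (𝓡 (d + 1)) 𝓘(ℝ, E') e x)) (t : ℝ)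
    (x : M) : F.pushField e t x ≠ 0 := fun h =>
  F.V_ne_zero (F.flow t x) (hinj _ (h.trans (map_zero _).symm))

lemma continuous_norm_pushDeriv (he : ContMDiff (𝓡 (d + 1)) 𝓘(ℝ, E') ∞ e) :
    Continuous fun p : TangentBundle (𝓡 (d + 1)) M => ‖F.pushDeriv e 0 p.1 p.2‖ := by
  simp only [F.pushDeriv_zero]
  have h1 := he.continuous_tangentMap (by simp)
  have h2 := (contMDiff_snd_tangentBundle_modelSpace (n := 0)
    (E') 𝓘(ℝ, E')).continuous
  exact (h2.comp h1).norm

lemma continuous_pushField (he : ContMDiff (𝓡 (d + 1)) 𝓘(ℝ, E') ∞ e) :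
    Continuous fun q : ℝ × M => F.pushField e q.1 q.2 := by
  have h1 := he.continuous_tangentMap (by simp)
  have h2 := (contMDiff_snd_tangentBundle_modelSpace (n := 0)
    (E') 𝓘(ℝ, E')).continuous
  have h3 : Continuous fun q : ℝ × M => F.flow q.1 q.2 := F.smooth_flow.continuous
  exact (h2.comp h1).comp (F.smooth_V.continuous.comp h3)

/-- The lengths of the periodic orbits are bounded below. -/
theorem exists_pos_le_of_flow_eq_of_immersion [CompactSpace M]
    (he : ContMDiff (𝓡 (d + 1)) 𝓘(ℝ, E') ∞ e)
    (hinj : ∀ x, Function.Injective (mfderiv (𝓡 (d + 1)) 𝓘(ℝ, E') e x)) :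
    ∃ T₀ > 0, ∀ (T : ℝ) (x : M), 0 < T → F.flow T x = x → T₀ ≤ T := by
  rcases isEmpty_or_nonempty M with hM | hM
  · exact ⟨1, one_pos, fun T x => hM.elim x⟩
  have hcont := F.continuous_pushField he
  have h0 : Continuous fun x : M => ‖F.pushField e 0 x‖ :=
    (hcont.comp (Continuous.prodMk_right 0)).norm
  obtain ⟨x₀, -, hx₀⟩ := isCompact_univ.exists_isMinOn univ_nonempty h0.continuousOn
  set c := ‖F.pushField e 0 x₀‖ with hc
  have hc0 : 0 < c := norm_pos_iff.2 (F.pushField_ne_zero hinj 0 x₀)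
  -- With c the least speed of the embedded trajectories, compactness gives a time T₀ before which
  -- every velocity stays within c of its initial value. A trajectory closing up earlier would have
  -- mean velocity 0, at distance at least c from the initial one.
  have hopen : IsOpen {q : ℝ × M | ‖F.pushField e q.1 q.2 - F.pushField e 0 q.2‖ < c} := by
    refine isOpen_lt (Continuous.norm (hcont.sub (hcont.comp (?_ : Continuous fun q : ℝ × M =>
      ((0 : ℝ), q.2))))) continuous_const
    fun_prop
  obtain ⟨u, v, hu, -, h0u, hMv, huv⟩ := generalized_tube_lemma (s := {(0 : ℝ)}) isCompact_singleton
    (t := (univ : Set M)) isCompact_univ hopen (by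
      rintro ⟨t, x⟩ ⟨ht, -⟩
      obtain rfl : t = 0 := ht
      simpa using hc0)
  obtain ⟨T₀, hT₀, hball⟩ := Metric.isOpen_iff.1 hu 0 (h0u rfl)
  refine ⟨T₀, hT₀, fun T x hT hx => ?_⟩
  by_contra hlt
  have hd : ∀ t ∈ Icc 0 T, HasDerivWithinAt (fun s => e (F.flow s x) - s • F.pushField e 0 x)
      (F.pushField e t x - F.pushField e 0 x) (Icc 0 T) t := fun t _ => by
    have h1 : HasDerivAt (fun s : ℝ => s • F.pushField e 0 x) (F.pushField e 0 x) t := by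
      simpa using (hasDerivAt_id t).smul_const (F.pushField e 0 x)
    exact ((F.hasDerivAt_comp_flow he t x).sub h1).hasDerivWithinAt
  have hlt' : ∀ t ∈ Icc 0 T, ‖F.pushField e t x - F.pushField e 0 x‖ < c := fun t ht => by
    have : (t, x) ∈ u ×ˢ v := ⟨hball (by
      rw [Metric.mem_ball, Real.dist_eq, sub_zero, abs_of_nonneg ht.1]
      linarith [ht.2]), hMv (mem_univ x)⟩
    exact huv this
  have hsub : Continuous fun t => ‖F.pushField e t x - F.pushField e 0 x‖ :=
    ((hcont.comp (Continuous.prodMk_left x)).sub continuous_const).norm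
  obtain ⟨t₁, ht₁, hmax⟩ := isCompact_Icc.exists_isMaxOn (nonempty_Icc.2 hT.le) hsub.continuousOn
  have hmv := Convex.norm_image_sub_le_of_norm_hasDerivWithin_le hd (fun t ht => hmax ht)
    (convex_Icc 0 T) (left_mem_Icc.2 hT.le) (right_mem_Icc.2 hT.le)
  simp only [F.flow.map_zero_apply, hx, zero_smul, sub_zero] at hmv
  rw [show e x - T • F.pushField e 0 x - e x = -(T • F.pushField e 0 x) by abel, norm_neg, norm_smul,
    mul_comm] at hmv
  have h2 := le_of_mul_le_mul_right hmv (norm_pos_iff.2 hT.ne')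
  have h3 : c ≤ ‖F.pushField e 0 x‖ := hx₀ (mem_univ x)
  linarith [hlt' t₁ ht₁]

end Observable

end AnosovFlow

/-! ### Linearization of nearby trajectories -/

namespace AnosovFlow

variable {d : ℕ} {M : Type u} [TopologicalSpace M] [ChartedSpace (EuclideanSpace ℝ (Fin (d + 1))) M]
  [IsManifold (𝓡 (d + 1)) ∞ M] (F : AnosovFlow d M)
  {E' : Type*} [NormedAddCommGroup E'] [NormedSpace ℝ E'] {e : M → E'}

/-- Strict differentiability of `(t, z) ↦ e (φ^t z)` in the chart at `p`. -/
lemma hasStrictFDerivAt_comp_flow (he : ContMDiff (𝓡 (d + 1)) 𝓘(ℝ, E') ∞ e) (τ : ℝ) (p : M)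
    (A : EuclideanSpace ℝ (Fin (d + 1)) →L[ℝ] E') (hA : A = F.pushDeriv e τ p) :
    HasStrictFDerivAt (fun q : ℝ × EuclideanSpace ℝ (Fin (d + 1)) =>
      e (F.flow q.1 ((extChartAt (𝓡 (d + 1)) p).symm q.2)))
      (((1 : ℝ →L[ℝ] ℝ).smulRight (F.pushField e τ p)).coprod A)
      (τ, extChartAt (𝓡 (d + 1)) p p) := by
  set χ := extChartAt (𝓡 (d + 1)) p with hχ
  set G := fun q : ℝ × EuclideanSpace ℝ (Fin (d + 1)) => e (F.flow q.1 (χ.symm q.2)) with hG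
  have hsymm : ContMDiffAt 𝓘(ℝ, EuclideanSpace ℝ (Fin (d + 1))) (𝓡 (d + 1)) ∞ χ.symm (χ p) :=
    (contMDiffOn_extChartAt_symm p).contMDiffAt (extChartAt_target_mem_nhds p)
  have hp : χ.symm (χ p) = p := extChartAt_to_inv p
  have hcd : ContDiffAt ℝ 1 G (τ, χ p) := by
    rw [← contMDiffAt_iff_contDiffAt]
    have h1 : ContMDiffAt 𝓘(ℝ, ℝ × EuclideanSpace ℝ (Fin (d + 1))) (𝓡 (d + 1)) ∞
        (fun q : ℝ × EuclideanSpace ℝ (Fin (d + 1)) => χ.symm q.2) (τ, χ p) :=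
      ContMDiffAt.comp (τ, χ p) (I' := 𝓘(ℝ, EuclideanSpace ℝ (Fin (d + 1)))) hsymm
        contDiff_snd.contMDiff.contMDiffAt
    have h2 : ContMDiffAt 𝓘(ℝ, ℝ × EuclideanSpace ℝ (Fin (d + 1))) 𝓘(ℝ, ℝ) ∞
        (fun q : ℝ × EuclideanSpace ℝ (Fin (d + 1)) => q.1) (τ, χ p) :=
      contDiff_fst.contMDiff.contMDiffAt
    have h3 := (he.comp F.smooth_flow).contMDiffAt.comp (τ, χ p) (h2.prodMk h1)
    exact h3.of_le (by exact_mod_cast le_top)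
  have hstrict := hcd.hasStrictFDerivAt one_ne_zero
  have hfd := hstrict.hasFDerivAt
  suffices hG' : fderiv ℝ G (τ, χ p) =
      ((1 : ℝ →L[ℝ] ℝ).smulRight (F.pushField e τ p)).coprod A by
    rwa [hG'] at hstrict
  refine ContinuousLinearMap.ext fun q => ?_
  have hq : q = (q.1, (0 : EuclideanSpace ℝ (Fin (d + 1)))) + ((0 : ℝ), q.2) := by
    ext <;> simp
  rw [hq, ContinuousLinearMap.map_add, ContinuousLinearMap.map_add]
  congr 1
  · have h1 : HasFDerivAt (fun t : ℝ => (t, χ p))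
        (ContinuousLinearMap.inl ℝ ℝ (EuclideanSpace ℝ (Fin (d + 1)))) τ := hasFDerivAt_prodMk_left τ (χ p)
    have h2 : HasFDerivAt (fun t : ℝ => e (F.flow t (χ.symm (χ p)))) _ τ :=
      HasFDerivAt.comp τ (g := G) (f := fun t : ℝ => (t, χ p)) hfd h1
    rw [hp] at h2
    have h3 := h2.unique (F.hasDerivAt_comp_flow he τ p).hasFDerivAt
    have h4 := DFunLike.congr_fun h3 q.1
    simpa using h4
  · have h1 : HasFDerivAt (fun z : EuclideanSpace ℝ (Fin (d + 1)) => (τ, z))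
        (ContinuousLinearMap.inr ℝ ℝ (EuclideanSpace ℝ (Fin (d + 1)))) (χ p) := hasFDerivAt_prodMk_right τ (χ p)
    have h2 : HasFDerivAt (fun z => (e ∘ F.flow τ) (χ.symm z)) _ (χ p) :=
      HasFDerivAt.comp (χ p) (g := G) (f := fun z : EuclideanSpace ℝ (Fin (d + 1)) => (τ, z)) hfd h1
    have h3 : HasFDerivAt (fun z => (e ∘ F.flow τ) (χ.symm z)) A (χ p) := by
      have h4 : MDifferentiableAt (𝓡 (d + 1)) 𝓘(ℝ, E') (e ∘ F.flow τ) p :=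
        (he.comp (F.contMDiff_flow τ)).mdifferentiable (by simp) p
      have h5 := h4.hasMFDerivAt.2
      rw [ModelWithCorners.range_eq_univ] at h5
      have h6 : HasFDerivWithinAt (fun z => (e ∘ F.flow τ) (χ.symm z)) A univ (χ p) := by
        rw [hA]
        exact h5
      exact hasFDerivWithinAt_univ.1 h6
    have h4 := DFunLike.congr_fun (h2.unique h3) q.2
    simpa using h4

/-- Linearization of pairs of nearby trajectories which never separate: if the points `x n`, `y n`
approach each other, `y n` is the nearest point to `x n` on its local trajectory, and the flow does
not increase the distance between these trajectories, then in the limit there is a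
tangent vector transverse to the flow which stays bounded modulo the flow direction. -/
theorem exists_tangent_of_nearby_trajectories [CompactSpace M]
    (he : ContMDiff (𝓡 (d + 1)) 𝓘(ℝ, E') ∞ e) (he' : Function.Injective e)
    (hinj : ∀ x, Function.Injective (mfderiv (𝓡 (d + 1)) 𝓘(ℝ, E') e x))
    {l : Ultrafilter ℕ} {x y : ℕ → M} (hne : ∀ n, 0 < ‖e (y n) - e (x n)‖)
    (hlim : Tendsto (fun n => ‖e (y n) - e (x n)‖) l (𝓝 0))
    (hmin : ∃ η > 0, ∀ᶠ n in (l : Filter ℕ), ∀ s, |s| ≤ η →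
      ‖e (y n) - e (x n)‖ ≤ ‖e (F.flow s (y n)) - e (x n)‖)
    (hmax : ∀ τ : ℝ, ∃ r : ℕ → ℝ, Tendsto r l (𝓝 0) ∧ ∀ᶠ n in (l : Filter ℕ),
      ‖e (F.flow (τ + r n) (y n)) - e (F.flow τ (x n))‖ ≤ ‖e (y n) - e (x n)‖) :
    ∃ (p : M) (w : TangentSpace (𝓡 (d + 1)) p),
      (∀ κ : ℝ, 1 ≤ ‖F.pushDeriv e 0 p w + κ • F.pushField e 0 p‖) ∧
      ∀ τ : ℝ, ∃ κ : ℝ, ‖F.pushDeriv e τ p w + κ • F.pushField e τ p‖ ≤ 1 := by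
  obtain ⟨p, -, hp⟩ := isCompact_univ.ultrafilter_le_nhds (l.map x) (by simp)
  have hx : Tendsto x l (𝓝 p) := hp
  obtain ⟨p', -, hp'⟩ := isCompact_univ.ultrafilter_le_nhds (l.map y) (by simp)
  have hy' : Tendsto y l (𝓝 p') := hp'
  have hpp : p' = p := by
    have h1 := (((he.continuous.tendsto _).comp hy').sub ((he.continuous.tendsto _).comp hx)).norm
    have h2 := tendsto_nhds_unique h1 hlim
    exact he' (sub_eq_zero.1 (norm_eq_zero.1 h2))
  have hy : Tendsto y l (𝓝 p) := hpp ▸ hy'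
  set χ := extChartAt (𝓡 (d + 1)) p with hχ
  set δ := fun n => ‖e (y n) - e (x n)‖ with hδ
  set z := fun n => χ (x n) with hz
  set z' := fun n => χ (y n) with hz'
  have hzlim : Tendsto z l (𝓝 (χ p)) := (continuousAt_extChartAt p).tendsto.comp hx
  have hzlim' : Tendsto z' l (𝓝 (χ p)) := (continuousAt_extChartAt p).tendsto.comp hy
  have hzx : ∀ᶠ n in (l : Filter ℕ), χ.symm (z n) = x n :=
    (hx.eventually (extChartAt_source_mem_nhds p)).mono fun n hn => χ.left_inv hn
  have hzy : ∀ᶠ n in (l : Filter ℕ), χ.symm (z' n) = y n :=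
    (hy.eventually (extChartAt_source_mem_nhds p)).mono fun n hn => χ.left_inv hn
  let A : ℝ → EuclideanSpace ℝ (Fin (d + 1)) →L[ℝ] E' := fun τ => F.pushDeriv e τ p
  let U : ℝ → E' := fun τ => F.pushField e τ p
  -- Both points move with n, so the first-order expansion must be uniform in the base point; strict
  -- differentiability provides this.
  have herr : ∀ (τ : ℝ) (r : ℕ → ℝ), Tendsto r l (𝓝 0) →
      (fun n => e (F.flow (τ + r n) (y n)) - e (F.flow τ (x n)) - (r n • U τ + A τ (z' n - z n)))
        =o[(l : Filter ℕ)] fun n => (r n, z' n - z n) := by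
    intro τ r hr
    have h1 := (F.hasStrictFDerivAt_comp_flow he τ p (A τ) rfl).isLittleO
    have h2 : Tendsto (fun n => ((τ + r n, z' n), (τ, z n))) (l : Filter ℕ)
        (𝓝 ((τ, χ p), (τ, χ p))) := by
      refine Tendsto.prodMk_nhds (Tendsto.prodMk_nhds ?_ hzlim')
        (Tendsto.prodMk_nhds tendsto_const_nhds hzlim)
      simpa using hr.const_add τ
    refine (h1.comp_tendsto h2).congr' ?_ ?_
    · filter_upwards [hzx, hzy] with n hn1 hn2
      simp only [Function.comp_apply]
      rw [← hχ, hn1, hn2]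
      simp [U]
    · exact .of_forall fun n => by simp
  -- Immersivity bounds the coordinate differences by a multiple of `δ n`; after division by `δ n`
  -- they stay in a compact ball and converge to the vector `w`.
  obtain ⟨c, hc, hcA⟩ : ∃ c > 0, ∀ ζ, c * ‖ζ‖ ≤ ‖A 0 ζ‖ := by
    have hker : (A 0 : EuclideanSpace ℝ (Fin (d + 1)) →ₗ[ℝ] E').ker = ⊥ := by
      rw [LinearMap.ker_eq_bot]
      intro a b hab
      refine hinj p ?_
      have : F.pushDeriv e 0 p a = F.pushDeriv e 0 p b := hab
      rwa [F.pushDeriv_zero] at this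
    obtain ⟨K, hK, hKA⟩ := (A 0 : EuclideanSpace ℝ (Fin (d + 1)) →ₗ[ℝ] E').exists_antilipschitzWith hker
    refine ⟨(K : ℝ)⁻¹, by positivity, fun ζ => ?_⟩
    have := hKA.le_mul_dist ζ 0
    rw [map_zero, dist_zero_right, dist_zero_right] at this
    rw [inv_mul_le_iff₀ (by positivity)]
    exact this
  have hD : ∀ᶠ n in (l : Filter ℕ), ‖z' n - z n‖ ≤ 2 / c * δ n := by
    have h1 := (herr 0 (fun _ => 0) tendsto_const_nhds).bound (half_pos hc)
    filter_upwards [h1] with n hn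
    simp only [add_zero, F.flow.map_zero_apply, zero_smul, zero_add] at hn
    have h2 : ‖((0 : ℝ), z' n - z n)‖ = ‖z' n - z n‖ := by simp [Prod.norm_def]
    rw [h2] at hn
    have h3 := hcA (z' n - z n)
    have h4 : ‖A 0 (z' n - z n)‖ ≤ δ n + c / 2 * ‖z' n - z n‖ := by
      have := norm_sub_norm_le (A 0 (z' n - z n)) (e (y n) - e (x n))
      rw [norm_sub_rev (A 0 _)] at this
      linarith
    rw [div_mul_eq_mul_div, le_div_iff₀ hc]
    linarith
  obtain ⟨w, -, hw⟩ := (isCompact_closedBall (0 : EuclideanSpace ℝ (Fin (d + 1))) (2 / c)).ultrafilter_le_nhds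
    (l.map fun n => (δ n)⁻¹ • (z' n - z n)) (by
      refine le_principal_iff.2 (hD.mono fun n hn => ?_ : ∀ᶠ n in (l : Filter ℕ), _)
      rw [mem_closedBall_zero_iff, norm_smul, norm_inv, Real.norm_of_nonneg (hne n).le,
        inv_mul_le_iff₀ (hne n), mul_comm]
      exact hn)
  have hw : Tendsto (fun n => (δ n)⁻¹ • (z' n - z n)) l (𝓝 w) := hw
  have hmain : ∀ (τ κ : ℝ) (r : ℕ → ℝ), Tendsto r l (𝓝 0) →
      Tendsto (fun n => (δ n)⁻¹ * r n) l (𝓝 κ) →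
      Tendsto (fun n => (δ n)⁻¹ * ‖e (F.flow (τ + r n) (y n)) - e (F.flow τ (x n))‖) l
        (𝓝 ‖A τ w + κ • U τ‖) := by
    intro τ κ r hr hrκ
    have hO : (fun n => (r n, z' n - z n)) =O[(l : Filter ℕ)] δ := by
      have h1 : Tendsto (fun n => (δ n)⁻¹ • (r n, z' n - z n)) l (𝓝 (κ, w)) := hrκ.prodMk_nhds hw
      refine Asymptotics.IsBigO.of_bound (‖(κ, w)‖ + 1) ?_
      filter_upwards [h1.norm.eventually_le_const (lt_add_one _)] with n hn
      rw [norm_smul, norm_inv, Real.norm_of_nonneg (hne n).le, inv_mul_le_iff₀ (hne n)] at hn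
      rwa [Real.norm_of_nonneg (hne n).le, mul_comm]
    have h1 := ((herr τ r hr).trans_isBigO hO).tendsto_inv_smul_nhds_zero
    have h2 : Tendsto (fun n => ((δ n)⁻¹ * r n) • U τ + A τ ((δ n)⁻¹ • (z' n - z n))) l
        (𝓝 (κ • U τ + A τ w)) := (hrκ.smul_const _).add (((A τ).continuous.tendsto w).comp hw)
    have h3 := (h1.add h2).norm
    rw [zero_add, add_comm (κ • U τ)] at h3
    refine h3.congr fun n => ?_
    rw [map_smul, mul_smul, ← smul_add, ← smul_add, sub_add_cancel, norm_smul, norm_inv,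
      Real.norm_of_nonneg (hne n).le]
  refine ⟨p, w, fun κ => ?_, fun τ => ?_⟩
  · obtain ⟨η, hη, hmin⟩ := hmin
    -- A time shift of order `δ n` becomes, after rescaling, a multiple κ of the flow direction; it
    -- is eventually small enough for `hmin`.
    have hr : Tendsto (fun n => κ * δ n) l (𝓝 0) := by simpa using hlim.const_mul κ
    have h1 := hmain 0 κ (fun n => κ * δ n) hr (tendsto_const_nhds.congr fun n => by
      have := (hne n).ne'
      change κ = (δ n)⁻¹ * (κ * δ n)
      rw [mul_comm κ, inv_mul_cancel_left₀ this])
    refine ge_of_tendsto h1 ?_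
    filter_upwards [hmin, hr.abs.eventually_le_const (by simpa using hη)] with n hn1 hn2
    have := hn1 _ hn2
    rw [zero_add, F.flow.map_zero_apply, ← div_eq_inv_mul, le_div_iff₀ (hne n), one_mul]
    exact this
  · obtain ⟨r, hr, hle⟩ := hmax τ
    have hU : 0 < ‖U τ‖ := norm_pos_iff.2 (F.pushField_ne_zero hinj τ p)
    set B := 2 / ‖U τ‖ * (1 + (‖A τ‖ + ‖U τ‖ / 2) * (2 / c)) with hB
    -- As the field does not vanish, the expansion can be solved for the time shift: it is of order
    -- `δ n`, so the quotients have a limit κ.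
    have hrB : ∀ᶠ n in (l : Filter ℕ), |r n| ≤ B * δ n := by
      filter_upwards [(herr τ r hr).bound (half_pos hU), hle, hD] with n hn1 hn2 hn3
      have h1 : ‖(r n, z' n - z n)‖ ≤ |r n| + ‖z' n - z n‖ := by
        rw [Prod.norm_def, Real.norm_eq_abs]
        exact max_le (by linarith [norm_nonneg (z' n - z n)]) (by linarith [abs_nonneg (r n)])
      have h2 : ‖r n • U τ‖ ≤ δ n + ‖A τ‖ * ‖z' n - z n‖ +
          ‖U τ‖ / 2 * (|r n| + ‖z' n - z n‖) := by
        have h3 : r n • U τ = (e (F.flow (τ + r n) (y n)) - e (F.flow τ (x n))) -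
            A τ (z' n - z n) - (e (F.flow (τ + r n) (y n)) - e (F.flow τ (x n)) -
              (r n • U τ + A τ (z' n - z n))) := by abel
        rw [h3]
        refine (norm_sub_le _ _).trans (add_le_add ((norm_sub_le _ _).trans
          (add_le_add hn2 ((A τ).le_opNorm _))) (hn1.trans ?_))
        gcongr
      rw [norm_smul, Real.norm_eq_abs] at h2
      have h4 : (‖A τ‖ + ‖U τ‖ / 2) * ‖z' n - z n‖ ≤ (‖A τ‖ + ‖U τ‖ / 2) * (2 / c * δ n) := by
        gcongr
      have h5 : B * δ n = 2 / ‖U τ‖ * (δ n + (‖A τ‖ + ‖U τ‖ / 2) * (2 / c * δ n)) := by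
        rw [hB]; ring
      rw [h5, div_mul_eq_mul_div, le_div_iff₀ hU]
      linarith
    obtain ⟨κ, -, hκ⟩ := (isCompact_closedBall (0 : ℝ) B).ultrafilter_le_nhds
      (l.map fun n => (δ n)⁻¹ * r n) (by
        refine le_principal_iff.2 (hrB.mono fun n hn => ?_ : ∀ᶠ n in (l : Filter ℕ), _)
        rw [mem_closedBall_zero_iff, norm_mul, norm_inv, Real.norm_of_nonneg (hne n).le,
          inv_mul_le_iff₀ (hne n), mul_comm]
        exact hn)
    refine ⟨κ, le_of_tendsto (hmain τ κ r hr hκ) ?_⟩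
    filter_upwards [hle] with n hn
    rw [inv_mul_le_iff₀ (hne n), mul_one]
    exact hn

end AnosovFlow

/-- A saddle point for a continuous function of two real variables, periodic in the first one. -/
lemma exists_max_min_of_periodic {f : ℝ → ℝ → ℝ} (hf : Continuous fun q : ℝ × ℝ => f q.1 q.2) {T : ℝ}
    (hT : 0 < T) (hper : ∀ t s, f (t + T) s = f t s) {η : ℝ} (hη : 0 ≤ η) :
    ∃ t s, |s| ≤ η ∧ (∀ s', |s'| ≤ η → f t s ≤ f t s') ∧
      ∀ t', ∃ s', |s'| ≤ η ∧ f t' s' ≤ f t s := by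
  have hne : (Icc (-η) η).Nonempty := nonempty_Icc.2 (by linarith)
  have hft : ∀ t, ContinuousOn (f t) (Icc (-η) η) := fun t =>
    (hf.comp (Continuous.prodMk_right t)).continuousOn
  -- The minimum over s is continuous and periodic in t, so it has a global maximum.
  set δ : ℝ → ℝ := fun t => sInf (f t '' Icc (-η) η) with hδ
  have hδc : Continuous δ := IsCompact.continuous_sInf isCompact_Icc hf
  have hmin : ∀ t, ∃ s ∈ Icc (-η) η, δ t = f t s ∧ ∀ s' ∈ Icc (-η) η, f t s ≤ f t s' := fun t =>
    isCompact_Icc.exists_sInf_image_eq_and_le hne (hft t)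
  have hδp : Function.Periodic δ T := fun t => by
    simp only [hδ]
    rw [show f (t + T) = f t from funext (hper t)]
  obtain ⟨t, -, ht⟩ := isCompact_Icc.exists_isMaxOn (nonempty_Icc.2 hT.le) hδc.continuousOn
  obtain ⟨s, hs, hδs, hs'⟩ := hmin t
  refine ⟨t, s, abs_le.2 hs, fun s' h => hs' s' (abs_le.1 h), fun t' => ?_⟩
  obtain ⟨s', hs1, hs2, -⟩ := hmin t'
  refine ⟨s', abs_le.2 hs1, ?_⟩
  obtain ⟨t₁, ht₁, heq⟩ := hδp.exists_mem_Ico₀ hT t'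
  rw [← hs2, ← hδs, heq]
  exact ht (Ico_subset_Icc_self ht₁)

/-! ### Hyperbolicity excludes bounded transverse vectors -/

namespace AnosovFlow

variable {d : ℕ} {M : Type u} [TopologicalSpace M] [ChartedSpace (EuclideanSpace ℝ (Fin (d + 1))) M]
  [IsManifold (𝓡 (d + 1)) ∞ M] (F : AnosovFlow d M)
  {E' : Type*} [NormedAddCommGroup E'] [NormedSpace ℝ E'] {e : M → E'}

/-- The Riemannian norm of a tangent vector. -/
noncomputable def riemannianNorm
    (ρ : Bundle.ContMDiffRiemannianMetric (𝓡 (d + 1)) ∞ (EuclideanSpace ℝ (Fin (d + 1)))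
      (fun x : M => TangentSpace (𝓡 (d + 1)) x)) (x : M) (v : TangentSpace (𝓡 (d + 1)) x) : ℝ :=
  √(ρ.inner x v v)

section RiemannianNorm

variable (ρ : Bundle.ContMDiffRiemannianMetric (𝓡 (d + 1)) ∞ (EuclideanSpace ℝ (Fin (d + 1)))
      (fun x : M => TangentSpace (𝓡 (d + 1)) x))

lemma riemannianNorm_smul (x : M) (c : ℝ) (v : TangentSpace (𝓡 (d + 1)) x) :
    riemannianNorm ρ x (c • v) = |c| * riemannianNorm ρ x v := by
  rw [riemannianNorm, riemannianNorm, map_smul, map_smul, smul_apply, smul_eq_mul,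
    smul_eq_mul, ← mul_assoc, Real.sqrt_mul (mul_self_nonneg c), Real.sqrt_mul_self_eq_abs]

lemma riemannianNorm_pos (x : M) {v : TangentSpace (𝓡 (d + 1)) x} (hv : v ≠ 0) :
    0 < riemannianNorm ρ x v := Real.sqrt_pos.2 (ρ.pos x v hv)

lemma riemannianNorm_nonneg (x : M) (v : TangentSpace (𝓡 (d + 1)) x) :
    0 ≤ riemannianNorm ρ x v := Real.sqrt_nonneg _

lemma riemannianNorm_flow_add (s t : ℝ) (x : M) (v : TangentSpace (𝓡 (d + 1)) x) :
    riemannianNorm ρ (F.flow s (F.flow t x)) (mfderiv (𝓡 (d + 1)) (𝓡 (d + 1)) (F.flow s) (F.flow t x)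
      (mfderiv (𝓡 (d + 1)) (𝓡 (d + 1)) (F.flow t) x v)) =
    riemannianNorm ρ (F.flow (s + t) x) (mfderiv (𝓡 (d + 1)) (𝓡 (d + 1)) (F.flow (s + t)) x v) :=
  congrArg (fun q : TangentBundle (𝓡 (d + 1)) M => riemannianNorm ρ q.1 q.2)
    (F.tangentMap_flow_add s t ⟨x, v⟩).symm

lemma riemannianNorm_flow_zero (x : M) (v : TangentSpace (𝓡 (d + 1)) x) :
    riemannianNorm ρ (F.flow 0 x) (mfderiv (𝓡 (d + 1)) (𝓡 (d + 1)) (F.flow 0) x v) =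
      riemannianNorm ρ x v :=
  congrArg (fun q : TangentBundle (𝓡 (d + 1)) M => riemannianNorm ρ q.1 q.2)
    (F.tangentMap_flow_zero ⟨x, v⟩)

/-- Turns the contraction of one subbundle in one time direction into its expansion in the other. -/
lemma riemannianNorm_flow_neg (t : ℝ) (x : M) (v : TangentSpace (𝓡 (d + 1)) x) :
    riemannianNorm ρ (F.flow (-t) (F.flow t x)) (mfderiv (𝓡 (d + 1)) (𝓡 (d + 1)) (F.flow (-t))
      (F.flow t x) (mfderiv (𝓡 (d + 1)) (𝓡 (d + 1)) (F.flow t) x v)) = riemannianNorm ρ x v := by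
  rw [riemannianNorm_flow_add, neg_add_cancel, riemannianNorm_flow_zero]

end RiemannianNorm

lemma pushDeriv_eq_pushDeriv_zero (he : ContMDiff (𝓡 (d + 1)) 𝓘(ℝ, E') ∞ e) (t : ℝ) (x : M)
    (v : TangentSpace (𝓡 (d + 1)) x) :
    F.pushDeriv e t x v =
      F.pushDeriv e 0 (F.flow t x) (mfderiv (𝓡 (d + 1)) (𝓡 (d + 1)) (F.flow t) x v) := by
  rw [F.pushDeriv_eq he, F.pushDeriv_zero]
  rfl

/-- A tangent vector whose iterates stay bounded modulo the flow direction has no component along a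
direction which expands. -/
lemma eq_zero_of_bounded_iterates [CompactSpace M] (he : ContMDiff (𝓡 (d + 1)) 𝓘(ℝ, E') ∞ e)
    (hinj : ∀ x, Function.Injective (mfderiv (𝓡 (d + 1)) 𝓘(ℝ, E') e x))
    (ρ : Bundle.ContMDiffRiemannianMetric (𝓡 (d + 1)) ∞ (EuclideanSpace ℝ (Fin (d + 1)))
      (fun x : M => TangentSpace (𝓡 (d + 1)) x)) {C θ : ℝ} (hC : 0 < C) (hθ : 0 < θ) (hθ1 : θ < 1)
    (c : ℝ) {p : M} {w a b : TangentSpace (𝓡 (d + 1)) p} {r : ℝ} (hw : w = a + b + r • F.V p)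
    (ha : ∀ n : ℕ, riemannianNorm ρ p a ≤ C * θ ^ n * riemannianNorm ρ (F.flow (n * c) p)
      (mfderiv (𝓡 (d + 1)) (𝓡 (d + 1)) (F.flow (n * c)) p a))
    (hb : ∀ n : ℕ, riemannianNorm ρ (F.flow (n * c) p)
      (mfderiv (𝓡 (d + 1)) (𝓡 (d + 1)) (F.flow (n * c)) p b) ≤ C * θ ^ n * riemannianNorm ρ p b)
    (hbd : ∀ τ : ℝ, ∃ κ : ℝ, ‖F.pushDeriv e τ p w + κ • F.pushField e τ p‖ ≤ 1) : a = 0 := by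
  have hpd : ∀ x (v : TangentSpace (𝓡 (d + 1)) x), v ≠ 0 → 0 < ‖F.pushDeriv e 0 x v‖ := by
    intro x v hv
    rw [norm_pos_iff, F.pushDeriv_zero]
    exact fun h => hv (hinj x (h.trans (map_zero _).symm))
  have hom : ∀ (f : M → E') x (c : ℝ) (v : TangentSpace (𝓡 (d + 1)) x), 0 ≤ c →
      ‖F.pushDeriv f 0 x (c • v)‖ = c * ‖F.pushDeriv f 0 x v‖ := fun f x c v hc => by
    rw [map_smul, norm_smul, Real.norm_of_nonneg hc]
  have homρ : ∀ x (c : ℝ) (v : TangentSpace (𝓡 (d + 1)) x), 0 ≤ c →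
      riemannianNorm ρ x (c • v) = c * riemannianNorm ρ x v := fun x c v hc => by
    rw [riemannianNorm_smul, abs_of_nonneg hc]
  have hec : ContMDiff (𝓡 (d + 1)) 𝓘(ℝ, E') ∞ (e ∘ F.flow c) := he.comp (F.contMDiff_flow c)
  obtain ⟨K, hK, hKle⟩ := exists_le_mul_of_homogeneous
    (N₁ := fun x v => ‖F.pushDeriv (e ∘ F.flow c) 0 x v‖) (N₂ := fun x v => ‖F.pushDeriv e 0 x v‖)
    (F.continuous_norm_pushDeriv hec) (F.continuous_norm_pushDeriv he) (hom _) (hom _) hpd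
  obtain ⟨C₁, hC₁, hC₁le⟩ := exists_le_mul_of_homogeneous
    (N₁ := fun x v => ‖F.pushDeriv e 0 x v‖) (N₂ := riemannianNorm ρ)
    (F.continuous_norm_pushDeriv he) (continuous_riemannianNorm ρ) (hom _) homρ (fun x v => riemannianNorm_pos ρ x)
  obtain ⟨C₂, hC₂, hC₂le⟩ := exists_le_mul_of_homogeneous
    (N₁ := riemannianNorm ρ) (N₂ := fun x v => ‖F.pushDeriv e 0 x v‖)
    (continuous_riemannianNorm ρ) (F.continuous_norm_pushDeriv he) homρ (hom _) hpd
  have hKle' : ∀ x (v : TangentSpace (𝓡 (d + 1)) x),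
      ‖F.pushDeriv e c x v‖ ≤ K * ‖F.pushDeriv e 0 x v‖ := fun x v => by
    have := hKle x v
    rwa [F.pushDeriv_zero (e := e ∘ F.flow c)] at this
  have hfield : Continuous fun x : M => ‖F.pushField e 0 x‖ :=
    ((F.continuous_pushField he).comp (Continuous.prodMk_right 0)).norm
  obtain ⟨x₀, -, hx₀⟩ := isCompact_univ.exists_isMinOn ⟨p, mem_univ p⟩ hfield.continuousOn
  obtain ⟨x₁, -, hx₁⟩ := isCompact_univ.exists_isMaxOn ⟨p, mem_univ p⟩ hfield.continuousOn
  set m := ‖F.pushField e 0 x₀‖ with hm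
  have hm0 : 0 < m := norm_pos_iff.2 (F.pushField_ne_zero hinj 0 x₀)
  set Cu := ‖F.pushField e 0 x₁‖ with hCu
  have hpf : ∀ t x, F.pushField e t x = F.pushField e 0 (F.flow t x) := fun t x => by
    rw [F.pushField_add, zero_add]
  have hm1 : ∀ t x, m ≤ ‖F.pushField e t x‖ := fun t x => by
    rw [hpf]; exact hx₀ (mem_univ _)
  have hCu1 : ∀ t x, ‖F.pushField e t x‖ ≤ Cu := fun t x => by
    rw [hpf]; exact hx₁ (mem_univ _)
  choose κ hκ using fun n : ℕ => hbd (n * c)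
  -- The time-c map carries the corrected vector at step n, of size at most 1, to one of size at
  -- most K with the same coefficient κ n. Comparison with the corrected vector at step n + 1 bounds
  -- the change of κ, as the field has size at least m.
  have hstep : ∀ n, |κ (n + 1) - κ n| ≤ (1 + K) / m := by
    intro n
    have h1 : F.pushDeriv e (((n + 1 : ℕ) : ℝ) * c) p w + κ n • F.pushField e (((n + 1 : ℕ) : ℝ) * c) p =
        F.pushDeriv e c (F.flow (n * c) p)
          (mfderiv (𝓡 (d + 1)) (𝓡 (d + 1)) (F.flow (n * c)) p w + κ n • F.V (F.flow (n * c) p)) := by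
      rw [map_add, map_smul, ← F.pushDeriv_add he, F.pushDeriv_V he, F.pushField_add,
        show ((n + 1 : ℕ) : ℝ) * c = c + n * c by push_cast; ring]
    have h2 : ‖F.pushDeriv e (((n + 1 : ℕ) : ℝ) * c) p w +
        κ n • F.pushField e (((n + 1 : ℕ) : ℝ) * c) p‖ ≤ K := by
      rw [h1]
      refine (hKle' _ _).trans ?_
      have h3 := hκ n
      rw [F.pushDeriv_eq_pushDeriv_zero he, hpf, ← F.pushDeriv_V he, ← map_smul, ← map_add] at h3
      nlinarith
    have h3 : ‖(κ (n + 1) - κ n) • F.pushField e (((n + 1 : ℕ) : ℝ) * c) p‖ ≤ 1 + K := by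
      have h4 : (κ (n + 1) - κ n) • F.pushField e (((n + 1 : ℕ) : ℝ) * c) p =
          (F.pushDeriv e (((n + 1 : ℕ) : ℝ) * c) p w +
            κ (n + 1) • F.pushField e (((n + 1 : ℕ) : ℝ) * c) p) -
          (F.pushDeriv e (((n + 1 : ℕ) : ℝ) * c) p w +
            κ n • F.pushField e (((n + 1 : ℕ) : ℝ) * c) p) := by
        rw [sub_smul]; abel
      rw [h4]
      exact (norm_sub_le _ _).trans (add_le_add (hκ (n + 1)) h2)
    rw [norm_smul, Real.norm_eq_abs] at h3
    rw [le_div_iff₀ hm0]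
    exact (mul_le_mul_of_nonneg_left (hm1 _ _) (abs_nonneg _)).trans h3
  have hlin : ∀ n : ℕ, |κ n| ≤ |κ 0| + n * ((1 + K) / m) := by
    intro n
    induction n with
    | zero => simp
    | succ n ih =>
      have := abs_sub_abs_le_abs_sub (κ (n + 1)) (κ n)
      push_cast
      linarith [hstep n]
  have hθn : ∀ n : ℕ, θ ^ n ≤ 1 := fun n => pow_le_one₀ hθ.le hθ1.le
  set A := 1 + C₁ * (C * riemannianNorm ρ p b) + (|r| + |κ 0|) * Cu with hA
  set B := (1 + K) / m * Cu with hB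
  have hCu0 : 0 ≤ Cu := norm_nonneg _
  -- Since κ grows at most linearly and the image of b is bounded, so does the image of a; but a
  -- expands at least like θ^{-n}.
  have hbound : ∀ n : ℕ, riemannianNorm ρ p a ≤ C * C₂ * A * θ ^ n + C * C₂ * B * (n * θ ^ n) := by
    intro n
    have h1 : ‖F.pushDeriv e (n * c) p b‖ ≤ C₁ * (C * riemannianNorm ρ p b) := by
      rw [F.pushDeriv_eq_pushDeriv_zero he]
      refine (hC₁le _ _).trans ?_
      have h2 : C * θ ^ n * riemannianNorm ρ p b ≤ C * riemannianNorm ρ p b := by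
        have := mul_le_mul_of_nonneg_left (hθn n) hC.le
        exact mul_le_mul_of_nonneg_right (by linarith) (riemannianNorm_nonneg ρ p b)
      exact mul_le_mul_of_nonneg_left ((hb n).trans h2) hC₁.le
    have h2 : F.pushDeriv e (n * c) p a = (F.pushDeriv e (n * c) p w +
        κ n • F.pushField e (n * c) p) - F.pushDeriv e (n * c) p b -
        (r + κ n) • F.pushField e (n * c) p := by
      rw [hw, map_add, map_add, map_smul, F.pushDeriv_V he, add_smul]
      abel
    have h3 : ‖F.pushDeriv e (n * c) p a‖ ≤ A + B * n := by
      rw [h2]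
      have h4 : ‖(r + κ n) • F.pushField e (n * c) p‖ ≤
          (|r| + (|κ 0| + n * ((1 + K) / m))) * Cu := by
        rw [norm_smul, Real.norm_eq_abs]
        refine mul_le_mul ((abs_add_le _ _).trans ?_) (hCu1 _ _) (norm_nonneg _) (by positivity)
        linarith [hlin n]
      refine (norm_sub_le _ _).trans ?_
      have h5 := (norm_sub_le (F.pushDeriv e (n * c) p w + κ n • F.pushField e (n * c) p)
        (F.pushDeriv e (n * c) p b))
      have h6 := hκ n
      have h7 : A + B * n = 1 + C₁ * (C * riemannianNorm ρ p b) +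
          (|r| + (|κ 0| + n * ((1 + K) / m))) * Cu := by
        rw [hA, hB]; ring
      linarith
    have h4 := hC₂le (F.flow (n * c) p) (mfderiv (𝓡 (d + 1)) (𝓡 (d + 1)) (F.flow (n * c)) p a)
    rw [← F.pushDeriv_eq_pushDeriv_zero he] at h4
    calc riemannianNorm ρ p a ≤ C * θ ^ n * (C₂ * (A + B * n)) := by
          refine (ha n).trans ?_
          have : 0 ≤ C * θ ^ n := by positivity
          exact mul_le_mul_of_nonneg_left (h4.trans (mul_le_mul_of_nonneg_left h3 hC₂.le)) this
      _ = _ := by ring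
  have hlim : Tendsto (fun n : ℕ => C * C₂ * A * θ ^ n + C * C₂ * B * (n * θ ^ n)) atTop (𝓝 0) := by
    have h1 := (tendsto_pow_atTop_nhds_zero_of_lt_one hθ.le hθ1).const_mul (C * C₂ * A)
    have h2 := (tendsto_self_mul_const_pow_of_lt_one hθ.le hθ1).const_mul (C * C₂ * B)
    simpa using h1.add h2
  by_contra ha0
  exact absurd (ge_of_tendsto' hlim hbound) (not_le.2 (riemannianNorm_pos ρ p ha0))

/-- A tangent vector transverse to the flow does not stay bounded modulo the flow direction. -/
lemma false_of_bounded_orbit [CompactSpace M] (he : ContMDiff (𝓡 (d + 1)) 𝓘(ℝ, E') ∞ e)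
    (hinj : ∀ x, Function.Injective (mfderiv (𝓡 (d + 1)) 𝓘(ℝ, E') e x))
    {p : M} {w : TangentSpace (𝓡 (d + 1)) p}
    (hw : ∀ κ : ℝ, 1 ≤ ‖F.pushDeriv e 0 p w + κ • F.pushField e 0 p‖)
    (hbd : ∀ τ : ℝ, ∃ κ : ℝ, ‖F.pushDeriv e τ p w + κ • F.pushField e τ p‖ ≤ 1) : False := by
  obtain ⟨ρ, C, θ, hC, hθ, hθ1, hyp⟩ := F.hyperbolic
  have hpow : ∀ n : ℕ, θ ^ (n : ℝ) = θ ^ n := fun n => Real.rpow_natCast θ n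
  have hmem : w ∈ (F.Eu p ⊔ F.Es p) ⊔ Submodule.span ℝ {F.V p} := by
    rw [(F.isCompl p).sup_eq_top]; trivial
  obtain ⟨us, hus, v, hv, rfl⟩ := Submodule.mem_sup.1 hmem
  obtain ⟨a, ha, b, hb, rfl⟩ := Submodule.mem_sup.1 hus
  obtain ⟨r, rfl⟩ := Submodule.mem_span_singleton.1 hv
  have hflow : ∀ (E : ∀ x : M, Submodule ℝ (TangentSpace (𝓡 (d + 1)) x)) (t : ℝ)
      (_ : (E p).map (mfderiv (𝓡 (d + 1)) (𝓡 (d + 1)) (F.flow t) p).toLinearMap = E (F.flow t p))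
      (v : TangentSpace (𝓡 (d + 1)) p), v ∈ E p →
      mfderiv (𝓡 (d + 1)) (𝓡 (d + 1)) (F.flow t) p v ∈ E (F.flow t p) := by
    intro E t h v hv
    rw [← h]
    exact Submodule.mem_map_of_mem hv
  -- Forward iteration (c = 1) kills the unstable component; backward iteration (c = -1) kills the
  -- stable one. What remains is a multiple of the field, which a suitable κ cancels.
  have ha0 : a = 0 := by
    refine F.eq_zero_of_bounded_iterates he hinj ρ hC hθ hθ1 1 rfl (fun n => ?_) (fun n => ?_) hbd
    · have h1 := (hyp n n.cast_nonneg (F.flow n p)).2 _ (hflow F.Eu n (F.map_Eu n p) a ha)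
      rw [hpow] at h1
      rw [mul_one, ← F.riemannianNorm_flow_neg ρ n p a]
      exact h1
    · have h1 := (hyp n n.cast_nonneg p).1 b hb
      rw [hpow] at h1
      rw [mul_one]
      exact h1
  have hb0 : b = 0 := by
    refine F.eq_zero_of_bounded_iterates he hinj ρ hC hθ hθ1 (-1) (a := b) (b := a)
      (by rw [add_comm a b]) (fun n => ?_) (fun n => ?_) hbd
    · have h1 := (hyp n n.cast_nonneg (F.flow (-n) p)).1 _ (hflow F.Es (-n) (F.map_Es (-n) p) b hb)
      rw [hpow] at h1
      have h2 := F.riemannianNorm_flow_neg ρ (-n) p b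
      rw [neg_neg] at h2
      rw [mul_neg, mul_one, ← h2]
      exact h1
    · have h1 := (hyp n n.cast_nonneg p).2 a ha
      rw [hpow] at h1
      rw [mul_neg, mul_one]
      exact h1
  have h1 := hw (-r)
  rw [ha0, hb0, add_zero, zero_add, map_smul, F.pushDeriv_V he, ← add_smul, add_neg_cancel, zero_smul,
    norm_zero] at h1
  linarith

end AnosovFlow

/-! ### Expansivity and counting of periodic orbits -/

namespace AnosovFlow

variable {d : ℕ} {M : Type u} [TopologicalSpace M] [ChartedSpace (EuclideanSpace ℝ (Fin (d + 1))) M]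
  [IsManifold (𝓡 (d + 1)) ∞ M] (F : AnosovFlow d M)
  {E' : Type*} [NormedAddCommGroup E'] {e : M → E'}

lemma continuous_uncurry_flow : Continuous fun q : ℝ × M => F.flow q.1 q.2 :=
  F.smooth_flow.continuous

/-- The flow is uniformly close to the identity for small times. -/
lemma exists_flow_close [CompactSpace M] (he : Continuous e) {ε : ℝ} (hε : 0 < ε) :
    ∃ h > 0, ∀ r, |r| ≤ h → ∀ z, ‖e (F.flow r z) - e z‖ ≤ ε := by
  have hopen : IsOpen {q : ℝ × M | ‖e (F.flow q.1 q.2) - e q.2‖ < ε} :=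
    isOpen_lt ((he.comp F.continuous_uncurry_flow).sub (he.comp continuous_snd)).norm continuous_const
  obtain ⟨u, v, hu, -, h0u, hMv, huv⟩ := generalized_tube_lemma (s := {(0 : ℝ)}) isCompact_singleton
    (t := (univ : Set M)) isCompact_univ hopen (by
      rintro ⟨t, x⟩ ⟨ht, -⟩
      obtain rfl : t = 0 := ht
      simpa using hε)
  obtain ⟨h, hh, hball⟩ := Metric.isOpen_iff.1 hu 0 (h0u rfl)
  refine ⟨h / 2, half_pos hh, fun r hr z => ?_⟩
  have : (r, z) ∈ u ×ˢ v := ⟨hball (by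
    rw [Metric.mem_ball, Real.dist_eq, sub_zero]; linarith), hMv (mem_univ z)⟩
  exact (huv this).le

variable [NormedSpace ℝ E']

/-- Expansivity for periodic orbits: two closed trajectories which have almost the same length and
stay close to each other coincide. -/
theorem exists_expansivity [CompactSpace M] (he : ContMDiff (𝓡 (d + 1)) 𝓘(ℝ, E') ∞ e)
    (he' : Function.Injective e)
    (hinj : ∀ x, Function.Injective (mfderiv (𝓡 (d + 1)) 𝓘(ℝ, E') e x)) :
    ∃ ε > 0, ∀ (x y : M) (T T' : ℝ), 0 < T → 0 < T' → F.flow T x = x → F.flow T' y = y →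
      |T - T'| ≤ ε → (∀ t ∈ Icc 0 T, ‖e (F.flow t y) - e (F.flow t x)‖ ≤ ε) →
      ∃ s, F.flow s y = x := by
  by_contra! hcon
  choose x y T T' hT hT' hx hy hTT hclose hne using fun n : ℕ =>
    hcon (1 / ((n : ℝ) + 1)) (by positivity)
  obtain ⟨T₀, hT₀, hmin⟩ := F.exists_pos_le_of_flow_eq_of_immersion he hinj
  set l := hyperfilter ℕ with hl
  have heps : Tendsto (fun n : ℕ => 1 / ((n : ℝ) + 1)) l (𝓝 0) :=
    tendsto_one_div_add_atTop_nhds_zero_nat.mono_left Nat.hyperfilter_le_atTop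
  -- Shifts bounded by η are shorter than any period, so a vanishing distance forces the shift
  -- itself to tend to 0 (`hshift`).
  set η := T₀ / 2 with hη
  have hη0 : 0 < η := half_pos hT₀
  -- The second orbit is run at a speed that makes both have the same period; the distance is then
  -- periodic in t and the saddle point lemma applies. Starting from the saddle, the distance
  -- between local trajectories is at its largest, hence does not increase at any later or earlier
  -- time.
  set c : ℕ → ℝ := fun n => T' n / T n with hc
  set f : ℕ → ℝ → ℝ → ℝ := fun n t s => ‖e (F.flow (c n * t + s) (y n)) - e (F.flow t (x n))‖ with hf
  have hcT : ∀ n, c n * T n = T' n := fun n => div_mul_cancel₀ _ (hT n).ne'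
  have hfper : ∀ n t s, f n (t + T n) s = f n t s := fun n t s => by
    simp only [hf]
    rw [show c n * (t + T n) + s = (c n * t + s) + T' n by rw [← hcT]; ring,
      F.flow.map_add _ (T' n), hy, F.flow.map_add _ (T n), hx]
  have hfcont : ∀ n, Continuous fun q : ℝ × ℝ => f n q.1 q.2 := fun n => by
    have h1 : Continuous fun q : ℝ × ℝ => F.flow (c n * q.1 + q.2) (y n) :=
      F.continuous_uncurry_flow.comp (by fun_prop : Continuous fun q : ℝ × ℝ => (c n * q.1 + q.2, y n))
    have h2 : Continuous fun q : ℝ × ℝ => F.flow q.1 (x n) :=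
      F.continuous_uncurry_flow.comp (by fun_prop : Continuous fun q : ℝ × ℝ => (q.1, x n))
    exact ((he.continuous.comp h1).sub (he.continuous.comp h2)).norm
  choose t s hs hst hmax using fun n => exists_max_min_of_periodic (hfcont n) (hT n) (hfper n) hη0.le
  have hnear : ∀ t' : ℕ → ℝ, Tendsto (fun n => f n (t' n) 0) l (𝓝 0) := by
    intro t'
    refine Metric.tendsto_nhds.2 fun ε hε => ?_
    obtain ⟨h, hh, hclose'⟩ := F.exists_flow_close he.continuous (half_pos hε)
    filter_upwards [heps.eventually_le_const hh, heps.eventually_lt_const (half_pos hε)] with n hn1 hn2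
    have hp : Function.Periodic (fun t => f n t 0) (T n) := fun t => hfper n t 0
    obtain ⟨τ, hτ, heq⟩ := hp.exists_mem_Ico₀ (hT n) (t' n)
    have heq' : f n (t' n) 0 = f n τ 0 := heq
    rw [heq', Real.dist_eq, sub_zero, abs_of_nonneg (norm_nonneg _)]
    have h1 : |(c n - 1) * τ| ≤ 1 / ((n : ℝ) + 1) := by
      have h2 : (c n - 1) * T n = T' n - T n := by rw [sub_mul, hcT, one_mul]
      rw [abs_mul, abs_of_nonneg hτ.1]
      calc |c n - 1| * τ ≤ |c n - 1| * T n := by gcongr; exact hτ.2.le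
        _ = |T n - T' n| := by
          rw [← abs_of_pos (hT n), ← abs_mul, abs_of_pos (hT n), h2, abs_sub_comm]
        _ ≤ _ := hTT n
    have h2 := hclose' _ (h1.trans hn1) (F.flow τ (y n))
    rw [← F.flow.map_add, show (c n - 1) * τ + τ = c n * τ + 0 by ring] at h2
    have h3 := hclose n τ (Ico_subset_Icc_self hτ)
    calc f n τ 0 ≤ ‖e (F.flow (c n * τ + 0) (y n)) - e (F.flow τ (y n))‖ +
          ‖e (F.flow τ (y n)) - e (F.flow τ (x n))‖ := norm_sub_le_norm_sub_add_norm_sub _ _ _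
      _ < ε := by linarith
  have hshift : ∀ t' s' : ℕ → ℝ, (∀ n, |s' n| ≤ η) →
      Tendsto (fun n => f n (t' n) (s' n)) l (𝓝 0) → Tendsto s' l (𝓝 0) := by
    intro t' s' hs' hlim
    set z := fun n => F.flow (c n * t' n) (y n) with hz
    obtain ⟨q, -, hq⟩ := isCompact_univ.ultrafilter_le_nhds (l.map z) (by simp)
    have hq : Tendsto z l (𝓝 q) := hq
    obtain ⟨σ, hσ, hσ'⟩ := (isCompact_Icc (a := -η) (b := η)).ultrafilter_le_nhds (l.map s')
      (le_principal_iff.2 (.of_forall fun n => abs_le.1 (hs' n) : ∀ᶠ n in (l : Filter ℕ), _))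
    have hσ' : Tendsto s' l (𝓝 σ) := hσ'
    have h1 : Tendsto (fun n => ‖e (F.flow (s' n) (z n)) - e (z n)‖) l
        (𝓝 ‖e (F.flow σ q) - e q‖) :=
      ((he.continuous.comp F.continuous_uncurry_flow).sub (he.continuous.comp continuous_snd)).norm
        |>.tendsto (σ, q) |>.comp (hσ'.prodMk_nhds hq)
    have h2 : Tendsto (fun n => ‖e (F.flow (s' n) (z n)) - e (z n)‖) l (𝓝 0) := by
      refine squeeze_zero (fun n => norm_nonneg _) (fun n => ?_)
        (by simpa using hlim.add (hnear t') : Tendsto (fun n => f n (t' n) (s' n) + f n (t' n) 0) l (𝓝 0))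
      have h3 : F.flow (s' n) (z n) = F.flow (c n * t' n + s' n) (y n) := by
        rw [hz, ← F.flow.map_add, add_comm]
      rw [h3]
      simp only [hf, add_zero]
      rw [norm_sub_rev (e (F.flow (c n * t' n) (y n)))]
      exact norm_sub_le_norm_sub_add_norm_sub _ _ _
    have h3 : F.flow σ q = q := he' (sub_eq_zero.1 (norm_eq_zero.1 (tendsto_nhds_unique h1 h2)))
    have h4 : σ = 0 := by
      rcases lt_trichotomy σ 0 with h | h | h
      · have h5 : F.flow (-σ) q = q := by
          conv_lhs => rw [← h3]
          rw [← F.flow.map_add, neg_add_cancel, F.flow.map_zero_apply]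
        have := hmin (-σ) q (by linarith) h5
        linarith [hσ.1]
      · exact h
      · have := hmin σ q h h3
        linarith [hσ.2]
    rwa [h4] at hσ'
  have hδlim : Tendsto (fun n => f n (t n) (s n)) l (𝓝 0) :=
    squeeze_zero (fun n => norm_nonneg _) (fun n => hst n 0 (by simpa using hη0.le)) (hnear t)
  have hslim := hshift t s hs hδlim
  have hclim : Tendsto c l (𝓝 1) := by
    rw [tendsto_iff_norm_sub_tendsto_zero]
    refine squeeze_zero (fun n => norm_nonneg _) (fun n => ?_) (by simpa only [zero_div] using heps.div_const T₀)
    have h1 : c n - 1 = (T' n - T n) / T n := by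
      have := (hT n).ne'
      simp only [hc]
      field_simp
    rw [h1, norm_div, Real.norm_eq_abs, Real.norm_of_nonneg (hT n).le, abs_sub_comm]
    exact div_le_div₀ (by positivity) (hTT n) hT₀ (hmin _ _ (hT n) (hx n))
  set X : ℕ → M := fun n => F.flow (t n) (x n) with hX
  set Y : ℕ → M := fun n => F.flow (c n * t n + s n) (y n) with hY
  have hpos : ∀ n, 0 < ‖e (Y n) - e (X n)‖ := by
    intro n
    rw [norm_pos_iff, sub_ne_zero]
    intro h
    refine hne n (-(t n) + (c n * t n + s n)) ?_
    have h1 : F.flow (c n * t n + s n) (y n) = F.flow (t n) (x n) := he' h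
    rw [F.flow.map_add, h1, ← F.flow.map_add, neg_add_cancel, F.flow.map_zero_apply]
  have hnearest : ∃ η > 0, ∀ᶠ n in (l : Filter ℕ), ∀ r, |r| ≤ η →
      ‖e (Y n) - e (X n)‖ ≤ ‖e (F.flow r (Y n)) - e (X n)‖ := by
    refine ⟨η / 2, half_pos hη0, ?_⟩
    filter_upwards [hslim.abs.eventually_le_const (show |(0 : ℝ)| < η / 2 by simpa using hη0)]
      with n hn r hr
    have := hst n (r + s n) ((abs_add_le _ _).trans (by linarith))
    rwa [hY, ← F.flow.map_add, show r + (c n * t n + s n) = c n * t n + (r + s n) by ring]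
  have hfar : ∀ τ : ℝ, ∃ r : ℕ → ℝ, Tendsto r l (𝓝 0) ∧ ∀ᶠ n in (l : Filter ℕ),
      ‖e (F.flow (τ + r n) (Y n)) - e (F.flow τ (X n))‖ ≤ ‖e (Y n) - e (X n)‖ := by
    intro τ
    choose s' hs' hle using fun n => hmax n (t n + τ)
    have hs'lim := hshift (fun n => t n + τ) s' hs' (squeeze_zero (fun n => norm_nonneg _) hle hδlim)
    -- The shift includes the drift (c - 1) τ due to the change of speed, which tends to 0 for fixed
    -- τ.
    refine ⟨fun n => (c n - 1) * τ + s' n - s n, ?_, .of_forall fun n => ?_⟩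
    · have h1 := (((hclim.sub_const 1).mul_const τ).add hs'lim).sub hslim
      simpa using h1
    · have h1 := hle n
      simp only [hf] at h1
      simp only [hX, hY]
      rw [← F.flow.map_add, ← F.flow.map_add,
        show τ + ((c n - 1) * τ + s' n - s n) + (c n * t n + s n) = c n * (t n + τ) + s' n by ring,
        add_comm τ]
      exact h1
  obtain ⟨p, w, hw1, hw2⟩ :=
    F.exists_tangent_of_nearby_trajectories he he' hinj hpos hδlim hnearest hfar
  exact F.false_of_bounded_orbit he hinj hw1 hw2

/-- The number of periodic orbits grows at most exponentially with the length. -/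
theorem exists_card_periodicOrbit_le [T2Space M] [CompactSpace M] :
    ∃ h > 0, ∃ K : ℕ, ∀ n : ℕ, ∀ S : Finset F.PeriodicOrbit,
      (∀ γ ∈ S, ⌊γ.length / h⌋₊ = n) → S.card ≤ K ^ (n + 1) := by
  obtain ⟨N, e, he, hemb, hinj⟩ := exists_embedding_euclidean_of_compact (I := 𝓡 (d + 1)) (M := M)
  obtain ⟨T₀, hT₀, hmin⟩ := F.exists_pos_le_of_flow_eq_of_immersion he hinj
  obtain ⟨ε, hε, hexp⟩ := F.exists_expansivity he hemb.injective hinj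
  obtain ⟨h₀, hh₀, hflow⟩ := F.exists_flow_close he.continuous (show 0 < ε / 3 by positivity)
  -- The sampling step: `h₀` controls the motion between samples, ε the difference of the lengths in
  -- a layer, and T₀ / 2 makes two periods of one trajectory in the same layer equal.
  set h := min h₀ (min ε (T₀ / 2)) with hh
  have hhpos : 0 < h := lt_min hh₀ (lt_min hε (half_pos hT₀))
  have hopen : ∀ z : M, IsOpen (e ⁻¹' Metric.ball (e z) (ε / 6)) := fun z =>
    Metric.isOpen_ball.preimage he.continuous
  obtain ⟨Z, hZ⟩ := isCompact_univ.elim_finite_subcover _ hopen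
    (fun z _ => mem_iUnion.2 ⟨z, Metric.mem_ball_self (by positivity)⟩)
  have hcov : ∀ x : M, ∃ z : Z, ‖e x - e z‖ < ε / 6 := fun x => by
    obtain ⟨z, hz, hxz⟩ := mem_iUnion₂.1 (hZ (mem_univ x))
    exact ⟨⟨z, hz⟩, by rwa [mem_preimage, mem_ball_iff_norm] at hxz⟩
  choose label hlabel using hcov
  refine ⟨h, hhpos, Z.card, fun n S hS => ?_⟩
  -- An orbit is coded by the balls met at the times k h. Orbits with the same code stay within ε/3
  -- + 2 (ε/6) + ε/3 = ε, so expansivity identifies them.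
  let code : F.PeriodicOrbit → (Fin (n + 1) → Z) := fun γ k => label (F.flow (k * h) γ.base)
  have hinjOn : Set.InjOn code S := by
    intro γ hγ γ' hγ' heq
    have hn := hS γ hγ
    have hn' := hS γ' hγ'
    have hfloor : ∀ γ : F.PeriodicOrbit, ⌊γ.length / h⌋₊ = n → n * h ≤ γ.length ∧
        γ.length < (n + 1) * h := fun γ hn => by
      have h1 := Nat.floor_le (div_nonneg γ.length_pos.le hhpos.le)
      have h2 := Nat.lt_floor_add_one (γ.length / h)
      rw [hn] at h1 h2
      exact ⟨(le_div_iff₀ hhpos).1 h1, (div_lt_iff₀ hhpos).1 h2⟩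
    obtain ⟨h1, h2⟩ := hfloor γ hn
    obtain ⟨h1', h2'⟩ := hfloor γ' hn'
    have hlen : |γ.length - γ'.length| < h := by
      rw [abs_lt]; constructor <;> nlinarith
    have hhε : h ≤ ε := (min_le_right _ _).trans (min_le_left _ _)
    have hhT : h ≤ T₀ / 2 := (min_le_right _ _).trans (min_le_right _ _)
    obtain ⟨s, hs⟩ := hexp γ.base γ'.base γ.length γ'.length γ.length_pos γ'.length_pos γ.flow_base
      γ'.flow_base (hlen.le.trans hhε) (fun t ht => by
        have hk0 := Nat.floor_le (div_nonneg ht.1 hhpos.le)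
        have hk1 := Nat.lt_floor_add_one (t / h)
        have hkn : ⌊t / h⌋₊ < n + 1 := by
          rw [Nat.lt_succ_iff, ← hn]
          exact Nat.floor_le_floor (by gcongr; exact ht.2)
        set k := ⌊t / h⌋₊
        rw [le_div_iff₀ hhpos] at hk0
        rw [div_lt_iff₀ hhpos] at hk1
        have hr : |t - k * h| ≤ h₀ := by
          rw [abs_of_nonneg (by linarith)]
          have : h ≤ h₀ := min_le_left _ _
          linarith
        have e1 := hflow _ hr (F.flow (k * h) γ.base)
        have e2 := hflow _ hr (F.flow (k * h) γ'.base)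
        rw [← F.flow.map_add, sub_add_cancel] at e1 e2
        have e3 : label (F.flow (k * h) γ.base) = label (F.flow (k * h) γ'.base) :=
          congrFun heq ⟨k, hkn⟩
        have e4 := hlabel (F.flow (k * h) γ.base)
        have e5 := hlabel (F.flow (k * h) γ'.base)
        rw [e3] at e4
        have e6 : e (F.flow t γ'.base) - e (F.flow t γ.base) =
            (e (F.flow t γ'.base) - e (F.flow (k * h) γ'.base)) +
            ((e (F.flow (k * h) γ'.base) - e (label (F.flow (k * h) γ'.base))) -
              (e (F.flow (k * h) γ.base) - e (label (F.flow (k * h) γ'.base)))) -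
            (e (F.flow t γ.base) - e (F.flow (k * h) γ.base)) := by abel
        rw [e6]
        refine (norm_sub_le _ _).trans ((add_le_add ((norm_add_le _ _).trans
          (add_le_add e2 ((norm_sub_le _ _).trans (add_le_add e5.le e4.le)))) e1).trans ?_)
        linarith)
    have himg : γ.image = γ'.image := by
      have i1 : γ.image = range (fun t => F.flow t γ.base) := γ.exists_base.choose_spec.1
      have i2 : γ'.image = range (fun t => F.flow t γ'.base) := γ'.exists_base.choose_spec.1
      rw [i1, i2]
      ext z
      constructor
      · rintro ⟨t, rfl⟩
        exact ⟨t + s, by simp only [F.flow.map_add, hs]⟩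
      · rintro ⟨t, rfl⟩
        refine ⟨t - s, ?_⟩
        simp only
        rw [← hs, ← F.flow.map_add, sub_add_cancel]
    have hlen' : γ.length = γ'.length := by
      have hb : F.flow γ'.length γ.base = γ.base := by
        rw [← hs, ← F.flow.map_add, add_comm, F.flow.map_add, γ'.flow_base]
      by_contra hne
      have key : ∀ a b : ℝ, F.flow a γ.base = γ.base → F.flow b γ.base = γ.base → a < b →
          |a - b| < h → False := by
        intro a b ha hb hab hlt
        have h3 : F.flow (b - a) γ.base = γ.base := by
          conv_lhs => rw [← ha]
          rw [← F.flow.map_add, sub_add_cancel, hb]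
        have := hmin (b - a) γ.base (by linarith) h3
        rw [abs_sub_comm, abs_of_pos (by linarith)] at hlt
        linarith
      rcases lt_or_gt_of_ne hne with hlt | hlt
      · exact key _ _ γ.flow_base hb hlt hlen
      · exact key _ _ hb γ.flow_base hlt (by rwa [abs_sub_comm])
    cases γ
    cases γ'
    simp only at himg hlen'
    subst himg hlen'
    rfl
  have hcard := Finset.card_le_card_of_injOn (t := Finset.univ) code (fun _ _ => Finset.mem_univ _) hinjOn
  simpa using hcard

end AnosovFlow

/-! ### Lower bounds for determinants -/

section LinearAlgebra

/-- A linear map which does not contract a norm by more than one half has determinant at least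
`2⁻ⁿ` in absolute value. -/
lemma one_le_two_pow_mul_abs_det {W : Type*} [NormedAddCommGroup W] [NormedSpace ℝ W]
    [FiniteDimensional ℝ W] (A : W →ₗ[ℝ] W) (hA : ∀ v, ‖v‖ ≤ 2 * ‖A v‖) :
    1 ≤ 2 ^ Module.finrank ℝ W * |LinearMap.det A| := by
  let : MeasurableSpace W := borel W
  have : BorelSpace W := ⟨rfl⟩
  let μ : Measure W := Measure.addHaar
  have hinj : Function.Injective A := by
    rw [injective_iff_map_eq_zero]
    intro v hv
    have := hA v
    rw [hv, norm_zero, mul_zero] at this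
    exact norm_le_zero_iff.1 this
  have hdet : LinearMap.det A ≠ 0 := by
    have := (LinearEquiv.ofInjectiveEndo A hinj).isUnit_det'
    exact this.ne_zero
  -- Volumes are compared: the preimage of the unit ball lies in the ball of radius 2.
  have h1 : μ (A ⁻¹' Metric.ball 0 1) = ENNReal.ofReal |(LinearMap.det A)⁻¹| * μ (Metric.ball 0 1) :=
    Measure.addHaar_preimage_linearMap μ hdet _
  have h2 : A ⁻¹' Metric.ball 0 1 ⊆ Metric.ball 0 (2 * 1) := by
    intro v hv
    rw [mem_preimage, mem_ball_zero_iff] at hv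
    rw [mem_ball_zero_iff]
    linarith [hA v]
  have h3 := measure_mono (μ := μ) h2
  rw [h1, Measure.addHaar_ball_mul_of_pos μ 0 two_pos] at h3
  have h4 := (ENNReal.mul_le_mul_iff_left (Metric.measure_ball_pos μ 0 one_pos).ne'
    measure_ball_lt_top.ne).1 h3
  rw [ENNReal.ofReal_le_ofReal_iff (by positivity), abs_inv,
    inv_le_iff_one_le_mul₀ (abs_pos.2 hdet)] at h4
  exact h4

/-- The norm is a plain function so that it can be adapted to the hyperbolic splitting,
independently of any norm already present on the space. -/
lemma one_le_two_pow_mul_abs_det_of_core {W : Type*} [AddCommGroup W] [Module ℝ W]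
    [FiniteDimensional ℝ W] (A : W →ₗ[ℝ] W) (N : W → ℝ) (h0 : ∀ v, 0 ≤ N v)
    (hsmul : ∀ (c : ℝ) v, N (c • v) = |c| * N v) (hadd : ∀ v w, N (v + w) ≤ N v + N w)
    (hzero : ∀ v, N v = 0 → v = 0) (hA : ∀ v, N v ≤ 2 * N (A v)) :
    1 ≤ 2 ^ Module.finrank ℝ W * |LinearMap.det A| := by
  let : Norm W := ⟨N⟩
  have core : NormedSpace.Core ℝ W :=
    { norm_nonneg := h0
      norm_smul := hsmul
      norm_triangle := hadd
      norm_eq_zero_iff := fun v => ⟨hzero v, fun h => by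
        have := hsmul 0 v
        rw [zero_smul, abs_zero, zero_mul] at this
        rw [h]; exact this⟩ }
  let : NormedAddCommGroup W := NormedAddCommGroup.ofCore core
  let : NormedSpace ℝ W := NormedSpace.ofCore core
  exact one_le_two_pow_mul_abs_det A hA

end LinearAlgebra

/-! ### The Poincaré determinant of long orbits -/

namespace AnosovFlow

variable {d : ℕ} {M : Type u} [TopologicalSpace M] [ChartedSpace (EuclideanSpace ℝ (Fin (d + 1))) M]
  [IsManifold (𝓡 (d + 1)) ∞ M]

section RiemannianNorm

variable (ρ : Bundle.ContMDiffRiemannianMetric (𝓡 (d + 1)) ∞ (EuclideanSpace ℝ (Fin (d + 1)))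
      (fun x : M => TangentSpace (𝓡 (d + 1)) x))

open scoped Bundle in
lemma riemannianNorm_add_le (x : M) (v w : TangentSpace (𝓡 (d + 1)) x) :
    riemannianNorm ρ x (v + w) ≤ riemannianNorm ρ x v + riemannianNorm ρ x w := by
  let : Bundle.RiemannianBundle (fun x : M => TangentSpace (𝓡 (d + 1)) x) :=
    ⟨ρ.toContinuousRiemannianMetric.toRiemannianMetric⟩
  have h : ∀ v : TangentSpace (𝓡 (d + 1)) x, riemannianNorm ρ x v = ‖v‖ := fun v => by
    rw [norm_eq_sqrt_real_inner]
    rfl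
  rw [h, h, h]
  exact norm_add_le _ _

lemma riemannianNorm_sub_le (x : M) (v w : TangentSpace (𝓡 (d + 1)) x) :
    riemannianNorm ρ x v ≤ riemannianNorm ρ x (v - w) + riemannianNorm ρ x w := by
  have := riemannianNorm_add_le ρ x (v - w) w
  rwa [sub_add_cancel] at this

lemma riemannianNorm_neg (x : M) (v : TangentSpace (𝓡 (d + 1)) x) :
    riemannianNorm ρ x (-v) = riemannianNorm ρ x v := by
  rw [← neg_one_smul ℝ v, riemannianNorm_smul, abs_neg, abs_one, one_mul]

lemma riemannianNorm_endOfEq {x y : M} (h : y = x)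
    (L : TangentSpace (𝓡 (d + 1)) x →ₗ[ℝ] TangentSpace (𝓡 (d + 1)) y)
    (v : TangentSpace (𝓡 (d + 1)) x) :
    riemannianNorm ρ x (endOfEq h L v) = riemannianNorm ρ y (L v) := by
  subst h
  rfl

end RiemannianNorm

variable (F : AnosovFlow d M)

/-- For long periodic orbits, `|det (I - P_γ)|` is bounded below. -/
theorem exists_one_le_absDet : ∃ (T₁ : ℝ) (D : ℝ), 0 < D ∧ ∀ γ : F.PeriodicOrbit, T₁ ≤ γ.length →
    1 ≤ D * γ.absDet := by
  obtain ⟨ρ, C, θ, hC, hθ, hθ1, hyp⟩ := F.hyperbolic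
  have hlim : Tendsto (fun T : ℝ => C * θ ^ T) atTop (𝓝 0) := by
    simpa using (tendsto_rpow_atTop_of_base_lt_one θ (by linarith) hθ1).const_mul C
  obtain ⟨T₁, hT₁⟩ := eventually_atTop.1 (hlim.eventually_le_const (show (0 : ℝ) < 1 / 2 by norm_num))
  refine ⟨T₁, 2 ^ (d + 1), by positivity, fun γ hγ => ?_⟩
  set T := γ.length
  set x := γ.base
  have hx : F.flow T x = x := γ.flow_base
  have hCT : C * θ ^ T ≤ 1 / 2 := hT₁ T hγ
  set R := F.returnDeriv T x hx with hR
  set N := riemannianNorm ρ x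
  have hRu : ∀ a ∈ F.Eu x, R a ∈ F.Eu x := fun a ha => by
    have h1 := map_endOfEq hx _ F.Eu (F.map_Eu T x)
    rw [← h1]
    exact Submodule.mem_map_of_mem ha
  have hRs : ∀ b ∈ F.Es x, R b ∈ F.Es x := fun b hb => by
    have h1 := map_endOfEq hx _ F.Es (F.map_Es T x)
    rw [← h1]
    exact Submodule.mem_map_of_mem hb
  have hNR : ∀ v, N (R v) = riemannianNorm ρ (F.flow T x)
      (mfderiv (𝓡 (d + 1)) (𝓡 (d + 1)) (F.flow T) x v) := fun v => riemannianNorm_endOfEq ρ hx _ v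
  have hN0 : ∀ v, 0 ≤ N v := riemannianNorm_nonneg ρ x
  have hNsmul : ∀ (c : ℝ) v, N (c • v) = |c| * N v := riemannianNorm_smul ρ x
  have hs : ∀ b ∈ F.Es x, N (R b) ≤ 1 / 2 * N b := fun b hb => by
    rw [hNR]
    exact ((hyp T γ.length_pos.le x).1 b hb).trans (mul_le_mul_of_nonneg_right hCT (hN0 b))
  have hu : ∀ a ∈ F.Eu x, N a ≤ 1 / 2 * N (R a) := fun a ha => by
    have hmem : mfderiv (𝓡 (d + 1)) (𝓡 (d + 1)) (F.flow T) x a ∈ F.Eu (F.flow T x) := by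
      rw [← F.map_Eu T x]
      exact Submodule.mem_map_of_mem ha
    have h1 := (hyp T γ.length_pos.le (F.flow T x)).2 _ hmem
    have h2 := F.riemannianNorm_flow_neg ρ T x a
    have h3 : N a ≤ C * θ ^ T * N (R a) := by
      rw [hNR]
      exact h2.symm.le.trans h1
    exact h3.trans (mul_le_mul_of_nonneg_right hCT (hN0 _))
  set W := F.Eu x ⊔ F.Es x with hW
  have hdec : ∀ v : W, ∃ a ∈ F.Eu x, ∃ b ∈ F.Es x, a + b = v := fun v => Submodule.mem_sup.1 v.2
  choose a ha b hb hab using hdec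
  have huniq : ∀ (v : W) (a' b' : TangentSpace (𝓡 (d + 1)) x), a' ∈ F.Eu x → b' ∈ F.Es x →
      a' + b' = v → a v = a' ∧ b v = b' := by
    intro v a' b' ha' hb' hv
    have h1 : a v - a' = b' - b v := by
      rw [sub_eq_sub_iff_add_eq_add, hab, add_comm b' a', hv]
    have h2 : a v - a' = 0 := Submodule.disjoint_def.1 (F.disjoint x) _
      (Submodule.sub_mem _ (ha v) ha') (h1 ▸ Submodule.sub_mem _ hb' (hb v))
    rw [h2] at h1
    exact ⟨sub_eq_zero.1 h2, (sub_eq_zero.1 h1.symm).symm⟩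
  obtain ⟨P, hPdef⟩ : ∃ P, P = F.poincareMap T x hx := ⟨_, rfl⟩
  have hP : ∀ v : W, ((P v : W) : TangentSpace (𝓡 (d + 1)) x) = R v := fun v => by
    rw [hPdef]; rfl
  have hsub : ∀ v : W, (((LinearMap.id - P : W →ₗ[ℝ] W) v : W) : TangentSpace (𝓡 (d + 1)) x) =
      (v : TangentSpace (𝓡 (d + 1)) x) - R v := fun v => by
    rw [LinearMap.sub_apply, LinearMap.id_apply, Submodule.coe_sub, hP]
  have hfin : FiniteDimensional ℝ (TangentSpace (𝓡 (d + 1)) x) :=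
    inferInstanceAs (FiniteDimensional ℝ (EuclideanSpace ℝ (Fin (d + 1))))
  -- In the maximum norm of the two components, I - P shrinks by at most a factor 2: on the unstable
  -- part P at least doubles, on the stable part it at least halves.
  have key := one_le_two_pow_mul_abs_det_of_core (W := W) (LinearMap.id - P)
    (fun v => max (N (a v)) (N (b v))) (fun v => le_max_of_le_left (hN0 _)) (fun c v => by
      obtain ⟨h1, h2⟩ := huniq (c • v) (c • a v) (c • b v) (Submodule.smul_mem _ _ (ha v))
        (Submodule.smul_mem _ _ (hb v)) (by rw [← smul_add, hab]; rfl)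
      rw [h1, h2, hNsmul, hNsmul, ← mul_max_of_nonneg _ _ (abs_nonneg c)])
    (fun v w => by
      obtain ⟨h1, h2⟩ := huniq (v + w) (a v + a w) (b v + b w) (Submodule.add_mem _ (ha v) (ha w))
        (Submodule.add_mem _ (hb v) (hb w)) (by
          rw [add_add_add_comm, hab, hab]; rfl)
      rw [h1, h2]
      refine max_le ((riemannianNorm_add_le ρ x _ _).trans ?_)
        ((riemannianNorm_add_le ρ x _ _).trans ?_)
      · exact add_le_add (le_max_left _ _) (le_max_left _ _)
      · exact add_le_add (le_max_right _ _) (le_max_right _ _))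
    (fun v hv => by
      have h1 : N (a v) ≤ 0 := hv ▸ le_max_left _ _
      have h2 : N (b v) ≤ 0 := hv ▸ le_max_right _ _
      have h3 : a v = 0 := by
        by_contra h
        exact absurd h1 (not_le.2 (riemannianNorm_pos ρ x h))
      have h4 : b v = 0 := by
        by_contra h
        exact absurd h2 (not_le.2 (riemannianNorm_pos ρ x h))
      have h5 := hab v
      rw [h3, h4, add_zero] at h5
      exact Subtype.ext h5.symm)
    (fun v => by
      obtain ⟨h1, h2⟩ := huniq ((LinearMap.id - P : W →ₗ[ℝ] W) v) (a v - R (a v)) (b v - R (b v))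
        (Submodule.sub_mem _ (ha v) (hRu _ (ha v))) (Submodule.sub_mem _ (hb v) (hRs _ (hb v))) (by
          rw [sub_add_sub_comm, hab, hsub, ← hab v, LinearMap.map_add])
      rw [h1, h2, mul_max_of_nonneg _ _ zero_le_two]
      refine max_le (le_max_of_le_left ?_) (le_max_of_le_right ?_)
      · have h3 := riemannianNorm_sub_le ρ x (R (a v)) (a v)
        have h4 : N (R (a v) - a v) = N (a v - R (a v)) := by
          rw [← neg_sub]; exact riemannianNorm_neg ρ x _
        have h5 := hu _ (ha v)
        have h6 : N (R (a v)) ≤ N (R (a v) - a v) + N (a v) := h3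
        linarith [hN0 (a v)]
      · have h3 : N (b v) ≤ N (b v - R (b v)) + N (R (b v)) := riemannianNorm_sub_le ρ x _ _
        linarith [hs _ (hb v)])
  have hrank : Module.finrank ℝ W ≤ d + 1 := by
    refine (Submodule.finrank_le W).trans ?_
    exact (finrank_euclideanSpace_fin (𝕜 := ℝ) (n := d + 1)).le
  refine key.trans ?_
  rw [hPdef]
  change _ ≤ 2 ^ (d + 1) * |LinearMap.det (LinearMap.id - F.poincareMap T x hx)|
  gcongr
  norm_num

end AnosovFlow

/-- Convergence of a geometric series over a set graded by `ℕ` whose layers grow exponentially. -/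
lemma summable_pow_of_card_le {ι : Type*} {f : ι → ℕ} {K : ℕ}
    (hK : ∀ n : ℕ, ∀ S : Finset ι, (∀ i ∈ S, f i = n) → S.card ≤ K ^ (n + 1)) {r : ℝ} (hr : 0 ≤ r)
    (hKr : K * r < 1) : Summable fun i => r ^ f i := by
  classical
  have hg : Summable fun n : ℕ => K * (K * r) ^ n :=
    (summable_geometric_of_lt_one (by positivity) hKr).mul_left _
  refine summable_of_sum_le (c := ∑' n : ℕ, K * (K * r) ^ n) (fun i => by positivity) fun u => ?_
  rw [← Finset.sum_fiberwise_of_maps_to (t := u.image f) (g := f)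
    (fun i hi => Finset.mem_image_of_mem f hi)]
  refine (Finset.sum_le_sum fun n _ => ?_).trans (hg.sum_le_tsum (u.image f) fun n _ => by positivity)
  have h1 : ∑ i ∈ u with f i = n, r ^ f i = ∑ i ∈ u with f i = n, r ^ n :=
    Finset.sum_congr rfl fun i hi => by rw [(Finset.mem_filter.1 hi).2]
  rw [h1, Finset.sum_const, nsmul_eq_mul]
  have h2 : (({i ∈ u | f i = n} : Finset ι).card : ℝ) ≤ (K : ℝ) ^ (n + 1) := by
    exact_mod_cast hK n _ fun i hi => (Finset.mem_filter.1 hi).2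
  calc _ ≤ (K : ℝ) ^ (n + 1) * r ^ n := by gcongr
    _ = K * (K * r) ^ n := by rw [mul_pow]; ring

/-! ### Absolute convergence of the dynamical determinant -/

namespace AnosovFlow

variable {d : ℕ} {M : Type u} [TopologicalSpace M] [ChartedSpace (EuclideanSpace ℝ (Fin (d + 1))) M]
  [IsManifold (𝓡 (d + 1)) ∞ M] (F : AnosovFlow d M)

lemma PeriodicOrbit.primitiveLength_mem {F : AnosovFlow d M} (γ : F.PeriodicOrbit) :
    γ.primitiveLength ∈ Icc 0 γ.length := by
  refine ⟨Real.sInf_nonneg ?_, csInf_le ⟨0, ?_⟩ ⟨γ, rfl, rfl⟩⟩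
  · rintro _ ⟨γ', -, rfl⟩
    exact γ'.length_pos.le
  · rintro _ ⟨γ', -, rfl⟩
    exact γ'.length_pos.le

/-- The series of the dynamical determinant converges absolutely in a half-plane. -/
theorem exists_summable_detTerm [T2Space M] [CompactSpace M] {g : M → ℂ} (hg : Continuous g) :
    ∃ σ : ℝ, ∀ s : ℂ, σ < s.re → Summable (F.detTerm g s) := by
  obtain ⟨h, hh, K, hK⟩ := F.exists_card_periodicOrbit_le
  obtain ⟨T₁, D, hD, hdet⟩ := F.exists_one_le_absDet
  obtain ⟨G, hG⟩ := isCompact_univ.exists_bound_of_continuousOn hg.continuousOn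
  -- A bound for the exponential growth rate of the number of orbits; K + 1 keeps the logarithm
  -- nonnegative even when K = 0.
  set L := Real.log (K + 1) / h with hL
  have hL0 : 0 ≤ L := div_nonneg (Real.log_nonneg (by simp)) hh.le
  refine ⟨G + L, fun s hs => ?_⟩
  set q := s.re - G with hq
  have hqL : L < q := by linarith
  set r := Real.exp (-(q * h)) with hr
  have hr0 : 0 < r := Real.exp_pos _
  have hKpos : (0 : ℝ) < K + 1 := by positivity
  have hr1 : r < 1 / (K + 1) := by
    have h1 : Real.log (K + 1) < q * h := (div_lt_iff₀ hh).1 hqL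
    rw [one_div, hr, Real.exp_neg]
    exact inv_strictAnti₀ hKpos ((Real.log_lt_iff_lt_exp hKpos).1 h1)
  have hKr : K * r < 1 := by
    rw [lt_div_iff₀ hKpos] at hr1
    linarith
  have hrlt : r < 1 := hr1.trans_le (by
    rw [div_le_one hKpos]; simp)
  have hsum := summable_pow_of_card_le (f := fun γ : F.PeriodicOrbit => ⌊γ.length / h⌋₊) hK hr0.le hKr
  refine Summable.of_norm_bounded_eventually (hsum.mul_left D) ?_
  -- The determinant bound holds only for lengths at least T₁. Summability shows that all but
  -- finitely many orbits are that long.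
  have hev := hsum.tendsto_cofinite_zero.eventually_lt_const (pow_pos hr0 (⌊T₁ / h⌋₊))
  filter_upwards [hev] with γ hγ
  have hlt : ⌊T₁ / h⌋₊ < ⌊γ.length / h⌋₊ := (pow_lt_pow_iff_right_of_lt_one₀ hr0 hrlt).1 hγ
  have hT : T₁ ≤ γ.length := by
    by_contra hlt'
    have h1 : γ.length / h ≤ T₁ / h := by
      gcongr
      exact (not_le.1 hlt').le
    exact absurd hlt (not_lt.2 (Nat.floor_le_floor h1))
  have hpos := γ.length_pos
  obtain ⟨hp0, hp1⟩ := γ.primitiveLength_mem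
  have e1 : ‖((γ.primitiveLength / γ.length : ℝ) : ℂ)‖ ≤ 1 := by
    rw [Complex.norm_real, Real.norm_of_nonneg (by positivity), div_le_one hpos]
    exact hp1
  have e2 : ‖Complex.exp (γ.integral g)‖ ≤ Real.exp (G * γ.length) := by
    rw [Complex.norm_exp]
    refine Real.exp_le_exp.2 ((Complex.re_le_norm _).trans ?_)
    have := intervalIntegral.norm_integral_le_of_norm_le_const (a := 0) (b := γ.length) (C := G)
      (f := fun t => g (F.flow t γ.base)) (fun t _ => hG _ (mem_univ _))
    rwa [sub_zero, abs_of_pos hpos] at this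
  have e3 : ‖Complex.exp (-s * γ.length) / γ.absDet‖ ≤ Real.exp (-s.re * γ.length) * D := by
    have h1 := hdet γ hT
    have h2 : 0 < γ.absDet := by
      by_contra h3
      nlinarith
    rw [norm_div, Complex.norm_exp, Complex.norm_real, Real.norm_of_nonneg h2.le, div_le_iff₀ h2]
    have h3 : (-s * (γ.length : ℂ)).re = -s.re * γ.length := by simp
    rw [h3, mul_assoc]
    exact le_mul_of_one_le_right (Real.exp_pos _).le h1
  have e4 : Real.exp (G * γ.length) * Real.exp (-s.re * γ.length) ≤ r ^ ⌊γ.length / h⌋₊ := by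
    rw [← Real.exp_add, hr, ← Real.exp_nat_mul]
    refine Real.exp_le_exp.2 ?_
    have h1 := Nat.floor_le (div_nonneg hpos.le hh.le)
    rw [le_div_iff₀ hh] at h1
    have h2 := mul_le_mul_of_nonneg_left h1 (hL0.trans hqL.le)
    rw [hq] at h2 ⊢
    linarith
  calc ‖F.detTerm g s γ‖ ≤ 1 * Real.exp (G * γ.length) * (Real.exp (-s.re * γ.length) * D) := by
        rw [detTerm, norm_mul, norm_mul]
        gcongr
    _ = D * (Real.exp (G * γ.length) * Real.exp (-s.re * γ.length)) := by ring
    _ ≤ _ := by gcongr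

end AnosovFlow

/-- A sparse set of resonances is empty, and then the dynamical determinant is trivial. -/
theorem determinantEqOne_of_resonanceSumFinite {d : ℕ} {M : Type u} [TopologicalSpace M] [T2Space M]
    [CompactSpace M] [ChartedSpace (EuclideanSpace ℝ (Fin (d + 1))) M]
    [IsManifold (𝓡 (d + 1)) ∞ M] [MeasurableSpace M] [BorelSpace M] (F : AnosovFlow d M) {g : M → ℂ}
    (hg : Continuous g) (htrace : TraceFormula F g) {ρ : ℝ} (h0 : 0 ≤ ρ) (h1 : ρ < 1)
    (hρ : ResonanceSumFinite F g ρ) :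
    DeterminantEqOne F g ∧ ¬ ∃ (z : ℂ) (m : ℕ), IsResonance F g z m := by
  obtain ⟨N, e, he, -, hinj⟩ := exists_embedding_euclidean_of_compact (I := 𝓡 (d + 1)) (M := M)
  obtain ⟨T₀, hT₀, hmin⟩ := F.exists_pos_le_of_flow_eq_of_immersion he hinj
  have hE : IsEmpty (Resonance F g) := isEmpty_resonance htrace h0 h1 hρ hT₀ fun γ =>
    hmin γ.length γ.base γ.length_pos γ.flow_base
  obtain ⟨σ, hσ⟩ := F.exists_summable_detTerm hg
  refine ⟨⟨σ, fun s hs => ⟨hσ s hs, dynamicalDeterminant_eq_one htrace hE (hσ s hs)⟩⟩, ?_⟩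
  rintro ⟨z, m, hz⟩
  exact hE.false ⟨(z, m), hz⟩

end Ruelle

theorem corollary1p2 {d : ℕ} (hd : 2 ≤ d) {M : Type u} [TopologicalSpace M] [T2Space M]
    [CompactSpace M] [ChartedSpace (EuclideanSpace ℝ (Fin (d + 1))) M]
    [IsManifold (𝓡 (d + 1)) ∞ M] [MeasurableSpace M] [BorelSpace M]
    (F : Ruelle.AnosovFlow d M) (g : M → ℂ) (hg : ContMDiff (𝓡 (d + 1)) 𝓘(ℝ, ℂ) ∞ g)
    (htrace : Ruelle.TraceFormula F g) :
    ((∃ ρ : ℝ, 0 ≤ ρ ∧ ρ < 1 / 2 ∧ Ruelle.ResonanceSumFinite F g ρ) →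
      Ruelle.DeterminantEqOne F g ∧ ¬ ∃ (z : ℂ) (m : ℕ), Ruelle.IsResonance F g z m) ∧
    ((∀ x, (g x).im = 0) → (∃ ρ : ℝ, 0 ≤ ρ ∧ ρ < 1 ∧ Ruelle.ResonanceSumFinite F g ρ) →
      Ruelle.DeterminantEqOne F g ∧ ¬ ∃ (z : ℂ) (m : ℕ), Ruelle.IsResonance F g z m) := by
  have key := fun (ρ : ℝ) h0 h1 hρ => Ruelle.determinantEqOne_of_resonanceSumFinite F hg.continuous
    htrace (ρ := ρ) h0 h1 hρ
  exact ⟨fun ⟨ρ, h0, h1, hρ⟩ => key ρ h0 (by linarith) hρ, fun _ ⟨ρ, h0, h1, hρ⟩ => key ρ h0 h1 hρ⟩
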